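/- Let $L>0$, $s\in(0,1)$ and $\rho\in[\tfrac1s,\infty)$. For an $L$-periodic function $f:\mathbb R\to\mathbb R^3$ that has a weak derivative $f'$ (in the sense of locally integrable functions), put $$[f']_{s,\rho}:=\int_0^L\!\int_0^L\frac{|f'(x)-f'(y)|^\rho}{|x-y|_{\mathbb R/L\mathbb Z}^{1+s\rho}}\,dx\,dy,\qquad |x-y|_{\mathbb R/L\mathbb Z}:=\min_{k\in\mathbb Z}|x+Lk-y|,$$ and let $W^{1+s,\rho}(\mathbb R/L\mathbb Z,\mathbb R^3)$ be the space of those $f$ with $f,f'\in L^\rho(0,L)$ and $[f']_{s,\rho}<\infty$, with norm $\|f\|_{W^{1+s,\rho}}:=\big(\|f\|_{L^\rho(0,L)}^\rho+\|f'\|_{L^\rho(0,L)}^\rho+[f']_{s,\rho}\big)^{1/\rho}$. The length of such a curve is $\mathscr L(f):=\int_0^L|f'(x)|\,dx$. Let $\gamma\in W^{1+s,\rho}(\mathbb R/L\mathbb Z,\mathbb R^3)$ be parametrized by arclength, i.e. $|\gamma'|=1$ a.e. Let $\eta\in C^\infty(\mathbb R)$ be non-negative with $\operatorname{supp}\eta\subset[-1,1]$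 and $\int_{\mathbb R}\eta(x)\,dx=1$. For $\varepsilon>0$ set $\eta_\varepsilon(x):=\tfrac1\varepsilon\eta(\tfrac x\varepsilon)$, $\gamma_\varepsilon(x):=\int_{\mathbb R}\gamma(x-y)\eta_\varepsilon(y)\,dy$ and $c_\varepsilon:=\frac{\mathscr L(\gamma)}{\mathscr L(\gamma_\varepsilon)}\gamma_\varepsilon$. Then, for all sufficiently small $\varepsilon>0$, the arclength function $\sigma_\varepsilon(x):=\int_0^x|c_\varepsilon'(z)|\,dz$ is a bijection of $\mathbb R$, and $\tilde\gamma_\varepsilon:=c_\varepsilon\circ\sigma_\varepsilon^{-1}$ is the $L$-periodic arclength parametrization of $c_\varepsilon$ with $\tilde\gamma_\varepsilon(0)=c_\varepsilon(0)$ and belongs to $W^{1+s,\rho}(\mathbb R/L\mathbb Z,\mathbb R^3)$. Moreover, $$\|\tilde\gamma_\varepsilon-\gamma\|_{W^{1+s,\rho}}\longrightarrow 0\qquad\text{as }\varepsilon\to0^+ .$$ -/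

import Mathlib

open MeasureTheory Filter Topology Set
open scoped ENNReal ContDiff Convolution

noncomputable section

namespace FracSobolev

variable {E : Type*} [NormedAddCommGroup E] [NormedSpace ℝ E]

/-- `g` is a weak derivative of `f` on `ℝ` (both locally integrable, tested against smooth
compactly supported functions). For `L`-periodic `f` this is the weak derivative on `ℝ / Lℤ`. -/
def IsWeakDeriv (f g : ℝ → E) : Prop :=
  LocallyIntegrable f volume ∧ LocallyIntegrable g volume ∧
    ∀ φ : ℝ → ℝ, ContDiff ℝ ∞ φ → HasCompactSupport φ →
      ∫ x, deriv φ x • f x = -∫ x, φ x • g x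

open Classical in
/-- A representative of the weak derivative (unique up to null sets); `0` if there is none. -/
def weakDeriv (f : ℝ → E) : ℝ → E :=
  if h : ∃ g, IsWeakDeriv f g then h.choose else 0

/-- The double integral `[f]_{s,ρ}` over one period in each variable. The norm of the class of
`x - y` in `AddCircle L` is the periodic distance `min_k |x + L k - y|`. -/
def gagliardo (L s ρ : ℝ) (f : ℝ → E) : ℝ≥0∞ :=
  ∫⁻ x in Ioc 0 L, ∫⁻ y in Ioc 0 L,
    ‖f x - f y‖ₑ ^ ρ / ENNReal.ofReal ‖((x - y : ℝ) : AddCircle L)‖ ^ (1 + s * ρ)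

/-- Membership in the periodic fractional Sobolev space `W^{1+s,ρ}(ℝ / Lℤ, E)`. -/
structure MemSobolev (L s ρ : ℝ) (f : ℝ → E) : Prop where
  periodic : Function.Periodic f L
  exists_weakDeriv : ∃ g, IsWeakDeriv f g
  memLp : MemLp f (ENNReal.ofReal ρ) (volume.restrict (Ioc 0 L))
  memLp_weakDeriv : MemLp (weakDeriv f) (ENNReal.ofReal ρ) (volume.restrict (Ioc 0 L))
  gagliardo_lt_top : gagliardo L s ρ (weakDeriv f) < ⊤

/-- The `W^{1+s,ρ}` norm `(‖f‖_{L^ρ}^ρ + ‖f'‖_{L^ρ}^ρ + [f']_{s,ρ})^{1/ρ}`. -/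
def sobolevNorm (L s ρ : ℝ) (f : ℝ → E) : ℝ≥0∞ :=
  ((∫⁻ x in Ioc 0 L, ‖f x‖ₑ ^ ρ) + (∫⁻ x in Ioc 0 L, ‖weakDeriv f x‖ₑ ^ ρ)
    + gagliardo L s ρ (weakDeriv f)) ^ (1 / ρ)

/-- Length of one period of an `L`-periodic curve with a weak derivative. -/
def length (L : ℝ) (f : ℝ → E) : ℝ :=
  ∫ x in (0 : ℝ)..L, ‖weakDeriv f x‖

/-- The arclength function based at `0`. -/
def arclength (f : ℝ → E) (x : ℝ) : ℝ :=
  ∫ z in (0 : ℝ)..x, ‖weakDeriv f z‖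

/-- The curve has unit speed almost everywhere. -/
def IsUnitSpeed (f : ℝ → E) : Prop :=
  ∀ᵐ x, ‖weakDeriv f x‖ = 1

/-- Reparametrization by arclength with base point `0`: `f` composed with the inverse of its
arclength function (a true inverse when the speed of `f` is positive). -/
def arclengthParam (f : ℝ → E) (t : ℝ) : E :=
  f (Function.invFun (arclength f) t)

/-- `Γ` is the `L`-periodic unit speed parametrization of the curve `f`, starting at `f 0`. -/
structure IsArclengthParamOf (L : ℝ) (f Γ : ℝ → E) : Prop where
  bijective : Function.Bijective (arclength f)
  comp_arclength : ∀ x, Γ (arclength f x) = f x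
  start : Γ 0 = f 0
  periodic : Function.Periodic Γ L
  exists_weakDeriv : ∃ g, IsWeakDeriv Γ g
  unitSpeed : IsUnitSpeed Γ

/-- Smooth non-negative mollifier on `ℝ` supported in `[-1, 1]` with integral `1`. -/
structure IsMollifier (η : ℝ → ℝ) : Prop where
  contDiff : ContDiff ℝ ∞ η
  nonneg : ∀ x, 0 ≤ η x
  tsupport_subset : tsupport η ⊆ Icc (-1) 1
  integral_eq_one : ∫ x, η x = 1

/-- The convolution `γ_ε(x) = ∫ γ(x - y) η_ε(y) dy` with `η_ε(y) = ε⁻¹ η(y / ε)`. -/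
def mollify (η : ℝ → ℝ) (γ : ℝ → E) (ε : ℝ) : ℝ → E :=
  (fun y => 1 / ε * η (y / ε)) ⋆[ContinuousLinearMap.lsmul ℝ ℝ, volume] γ

/-- The convolution rescaled to the length of `γ`. -/
def rescaledMollify (L : ℝ) (η : ℝ → ℝ) (γ : ℝ → E) (ε : ℝ) : ℝ → E :=
  fun x => (length L γ / length L (mollify η γ ε)) • mollify η γ ε x

end FracSobolev

end

/-! The tangent of `γ` is a unit field `u`, and the tangent of `γ_ε` is its average against the
probability measure with density `η_ε`. Everything rests on a lower bound for the speed: as `1 ≤ s *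
ρ`, finiteness of the seminorm gives `u` vanishing mean oscillation, so the averages have norm
tending to 1 uniformly (`IsMollifier.eventually_le_norm_avg`). For each `θ < 1` and all small `ε`
the rescaled speed lies in `[θ, θ⁻¹]` and has mean one; arclength is then a bi-Lipschitz bijection,
close to the identity on a period.

The curves converge by Lipschitz estimates. The tangents converge in `L^ρ` by comparison with a
continuous average of `u` at a fixed scale `δ`, for which composition with the inverse arclength is
harmless.

The seminorm of the difference is never estimated directly. Averaging does not increase the seminorm
(`IsUnitPeriodic.gagliardo_avg_le`); normalizing and reparametrizing multiply it by constants that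
tend to 1 with `θ` (`gagliardo_normalize_le`, `IsSpeed.gagliardo_comp_time_le`). Hence the upper
limit of the seminorms is at most that of `u`. With a.e. convergence along a subsequence, Fatou's
lemma turns this into strong convergence (`tendsto_lintegral_enorm_sub_rpow`), and the subsequence
principle concludes. -/

noncomputable section

namespace FracSobolev

/-! ### Weak derivatives: uniqueness, mollification, good representatives. -/

section WeakDeriv

variable {E : Type*} [NormedAddCommGroup E] [NormedSpace ℝ E]

theorem IsWeakDeriv.ae_eq [CompleteSpace E] {f g g' : ℝ → E} (h : IsWeakDeriv f g)
    (h' : IsWeakDeriv f g') : g =ᵐ[volume] g' := by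
  refine ae_eq_of_integral_contDiff_smul_eq h.2.1 h'.2.1 fun φ hφ hc => ?_
  have h1 := h.2.2 φ hφ hc
  rw [h'.2.2 φ hφ hc] at h1
  exact (neg_injective h1).symm

theorem isWeakDeriv_weakDeriv {f : ℝ → E} (h : ∃ g, IsWeakDeriv f g) :
    IsWeakDeriv f (weakDeriv f) := by
  rw [weakDeriv, dif_pos h]
  exact h.choose_spec

theorem IsWeakDeriv.weakDeriv_ae_eq [CompleteSpace E] {f g : ℝ → E} (h : IsWeakDeriv f g) :
    weakDeriv f =ᵐ[volume] g :=
  (isWeakDeriv_weakDeriv ⟨g, h⟩).ae_eq h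

theorem IsWeakDeriv.congr_right {f g g' : ℝ → E} (h : IsWeakDeriv f g) (hg : g =ᵐ[volume] g') :
    IsWeakDeriv f g' := by
  refine ⟨h.1, (locallyIntegrable_congr hg).1 h.2.1, fun φ hφ hc => ?_⟩
  rw [h.2.2 φ hφ hc]
  congr 1
  refine integral_congr_ae ?_
  filter_upwards [hg] with x hx
  rw [hx]

theorem IsWeakDeriv.sub {f g f' g' : ℝ → E} (h : IsWeakDeriv f g)
    (h' : IsWeakDeriv f' g') : IsWeakDeriv (f - f') (g - g') := by
  refine ⟨h.1.sub h'.1, h.2.1.sub h'.2.1, fun φ hφ hc => ?_⟩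
  have hd : Continuous (deriv φ) := hφ.continuous_deriv (by simp)
  simp only [Pi.sub_apply, smul_sub]
  rw [integral_sub (h.1.integrable_smul_left_of_hasCompactSupport hd hc.deriv)
      (h'.1.integrable_smul_left_of_hasCompactSupport hd hc.deriv),
    integral_sub (h.2.1.integrable_smul_left_of_hasCompactSupport hφ.continuous hc)
      (h'.2.1.integrable_smul_left_of_hasCompactSupport hφ.continuous hc),
    h.2.2 φ hφ hc, h'.2.2 φ hφ hc]
  abel

theorem isWeakDeriv_of_hasDerivAt {f g : ℝ → E} (h : ∀ x, HasDerivAt f (g x) x)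
    (hg : Continuous g) : IsWeakDeriv f g := by
  have hf : Continuous f := continuous_iff_continuousAt.2 fun x => (h x).continuousAt
  refine ⟨hf.locallyIntegrable, hg.locallyIntegrable, fun φ hφ hc => ?_⟩
  have hd : Continuous (deriv φ) := hφ.continuous_deriv (by simp)
  have := integral_bilinear_hasDerivAt_right_eq_neg_left_of_integrable
    (L := ContinuousLinearMap.lsmul ℝ ℝ (E := E)) (u := φ) (v := f) (u' := deriv φ) (v' := g)
    (fun x _ => (hφ.differentiable (by simp) x).hasDerivAt) (fun x _ => h x)
    (hg.locallyIntegrable.integrable_smul_left_of_hasCompactSupport hφ.continuous hc)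
    (hf.locallyIntegrable.integrable_smul_left_of_hasCompactSupport hd hc.deriv)
    (hf.locallyIntegrable.integrable_smul_left_of_hasCompactSupport hφ.continuous hc)
  simp only [ContinuousLinearMap.lsmul_apply] at this
  rw [this, neg_neg]

theorem locallyIntegrable_comp_add {F : Type*} [NormedAddCommGroup F]
    {f : ℝ → F} (hf : LocallyIntegrable f volume) (a : ℝ) :
    LocallyIntegrable (fun x => f (x + a)) volume := by
  have := (locallyIntegrable_map_homeomorph (Homeomorph.addRight a) (f := f) (μ := volume)).1
  rw [Homeomorph.coe_addRight, map_add_right_eq_self] at this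
  exact this hf

theorem IsWeakDeriv.comp_add {f g : ℝ → E} (h : IsWeakDeriv f g) (a : ℝ) :
    IsWeakDeriv (fun x => f (x + a)) (fun x => g (x + a)) := by
  refine ⟨locallyIntegrable_comp_add h.1 a, locallyIntegrable_comp_add h.2.1 a,
    fun φ hφ hc => ?_⟩
  have hψ : ContDiff ℝ ∞ fun x => φ (x - a) := hφ.comp (contDiff_id.sub contDiff_const)
  have hcψ : HasCompactSupport fun x => φ (x - a) :=
    hc.comp_homeomorph (Homeomorph.subRight a)
  have := h.2.2 _ hψ hcψ
  rw [← integral_add_right_eq_self (fun x => deriv (fun x => φ (x - a)) x • f x) a,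
    ← integral_add_right_eq_self (fun x => φ (x - a) • g x) a] at this
  simpa [deriv_comp_sub_const] using this

theorem IsWeakDeriv.hasDerivAt_convolution [CompleteSpace E] {f g : ℝ → E} (h : IsWeakDeriv f g)
    {φ : ℝ → ℝ} (hφ : ContDiff ℝ ∞ φ) (hc : HasCompactSupport φ) (x : ℝ) :
    HasDerivAt (φ ⋆[ContinuousLinearMap.lsmul ℝ ℝ, volume] f)
      ((φ ⋆[ContinuousLinearMap.lsmul ℝ ℝ, volume] g) x) x := by
  have h1 := hc.hasDerivAt_convolution_left (ContinuousLinearMap.lsmul ℝ ℝ (E := E))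
    (hφ.of_le (by simp)) h.1 x
  convert h1 using 1
  rw [convolution_eq_swap, convolution_eq_swap]
  simp only [ContinuousLinearMap.lsmul_apply]
  have hψ : ContDiff ℝ ∞ fun t => φ (x - t) := hφ.comp (contDiff_const.sub contDiff_id)
  have hcψ : HasCompactSupport fun t => φ (x - t) :=
    hc.comp_homeomorph (Homeomorph.subLeft x)
  have h2 := h.2.2 _ hψ hcψ
  rw [← neg_eq_iff_eq_neg, ← integral_neg] at h2
  rw [← h2]
  refine integral_congr_ae (Eventually.of_forall fun t => ?_)
  simp [deriv_comp_const_sub]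

/-- A weakly differentiable periodic function with weak derivative of norm one has a
weak derivative which is everywhere periodic, of norm one, and strongly measurable. -/
theorem IsWeakDeriv.exists_periodic_unit [CompleteSpace E] {L : ℝ} (hL : 0 < L) {f g : ℝ → E}
    (h : IsWeakDeriv f g) (hf : Function.Periodic f L) (hg : ∀ᵐ x, ‖g x‖ = 1) :
    ∃ u : ℝ → E, IsWeakDeriv f u ∧ StronglyMeasurable u ∧ Function.Periodic u L ∧
      ∀ x, ‖u x‖ = 1 := by
  obtain ⟨x₀, hx₀⟩ := hg.exists
  have hm : AEStronglyMeasurable g volume := h.2.1.aestronglyMeasurable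
  set g₁ : ℝ → E := hm.mk g with hg₁
  have hgg₁ : g =ᵐ[volume] g₁ := hm.ae_eq_mk
  have hsm₁ : StronglyMeasurable g₁ := hm.stronglyMeasurable_mk
  -- Off a null set nothing changes; elsewhere the unit vector `g x₀` is substituted.
  let g₂ : ℝ → E := fun x => if ‖g₁ x‖ = 1 then g₁ x else g x₀
  have hsm₂ : StronglyMeasurable g₂ :=
    StronglyMeasurable.ite (hsm₁.norm.measurable (measurableSet_singleton 1)) hsm₁
      stronglyMeasurable_const
  have hn₂ : ∀ x, ‖g₂ x‖ = 1 := fun x => by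
    by_cases hx : ‖g₁ x‖ = 1 <;> simp [g₂, hx, hx₀]
  have hgg₂ : g =ᵐ[volume] g₂ := by
    filter_upwards [hgg₁, hg] with x h1 h2
    have h3 : ‖g₁ x‖ = 1 := by rw [← h1, h2]
    simp [g₂, h3, h1]
  have hw₂ := h.congr_right hgg₂
  -- Translating by `k • L` fixes `f`, so uniqueness gives a.e. invariance; there are only countably
  -- many `k`.
  have hper : ∀ᵐ x, ∀ k : ℤ, g₂ (x + k • L) = g₂ x := by
    rw [ae_all_iff]
    intro k
    have h3 := hw₂.comp_add (k • L)
    have h4 : (fun x => f (x + k • L)) = f := funext fun x => hf.zsmul k x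
    rw [h4] at h3
    exact h3.ae_eq hw₂
  refine ⟨fun x => g₂ (toIocMod hL 0 x), hw₂.congr_right ?_, ?_, ?_, fun x => hn₂ _⟩
  · filter_upwards [hper] with x hx
    rw [← hx (-toIocDiv hL 0 x), toIocMod]
    congr 1
    simp [sub_eq_add_neg]
  · refine hsm₂.comp_measurable ?_
    have : Fact (0 < L) := ⟨hL⟩
    exact measurable_subtype_coe.comp
      ((AddCircle.measurableEquivIoc L 0).measurable.comp AddCircle.measurable_mk')
  · intro x
    simp

/-- No continuity of `f` is available. Its mollifications are 1-Lipschitz because their derivatives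
average unit vectors; `A` is the full-measure set on which they converge to `f`, and the bound
passes to the limit there. -/
theorem IsWeakDeriv.ae_lipschitz [CompleteSpace E] {f u : ℝ → E} (h : IsWeakDeriv f u)
    (hu : ∀ x, ‖u x‖ = 1) :
    ∃ A : Set ℝ, (∀ᵐ x, x ∈ A) ∧ ∀ x ∈ A, ∀ y ∈ A, ‖f x - f y‖ ≤ |x - y| := by
  let φ : ℕ → ContDiffBump (0 : ℝ) := fun n =>
    ⟨1 / ((n : ℝ) + 1), 2 * (1 / ((n : ℝ) + 1)), by positivity, by
      have : 0 < 1 / ((n : ℝ) + 1) := by positivity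
      linarith⟩
  have hlim : Tendsto (fun n => (φ n).rOut) atTop (𝓝 0) := by
    have := (tendsto_one_div_add_atTop_nhds_zero_nat (𝕜 := ℝ)).const_mul 2
    simpa [φ] using this
  have hae := ContDiffBump.ae_convolution_tendsto_right_of_locallyIntegrable (μ := volume)
    (K := 2) hlim (Eventually.of_forall fun n => le_rfl) h.1
  refine ⟨{x | Tendsto (fun n => (((φ n).normed volume)
    ⋆[ContinuousLinearMap.lsmul ℝ ℝ, volume] f) x) atTop (𝓝 (f x))}, hae, fun x hx y hy => ?_⟩
  refine le_of_tendsto (Tendsto.sub hx hy).norm (Eventually.of_forall fun n => ?_)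
  have hbd : ∀ z, ‖(((φ n).normed volume) ⋆[ContinuousLinearMap.lsmul ℝ ℝ, volume] u) z‖ ≤ 1 := by
    intro z
    rw [convolution_def]
    calc _ ≤ ∫ t, (φ n).normed volume t := by
          refine norm_integral_le_of_norm_le (φ n).integrable_normed
            (Eventually.of_forall fun t => ?_)
          simp [norm_smul, hu, abs_of_nonneg ((φ n).nonneg_normed t)]
      _ = 1 := (φ n).integral_normed
  have := Convex.norm_image_sub_le_of_norm_hasDerivWithin_le (s := univ) (C := 1)
    (fun z _ => (h.hasDerivAt_convolution (φ n).contDiff_normed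
      (φ n).hasCompactSupport_normed z).hasDerivWithinAt) (fun z _ => hbd z) convex_univ
    (mem_univ y) (mem_univ x)
  simpa using this

end WeakDeriv

/-! ### Integrals of periodic functions over one period. -/

section Periodic

theorem setLIntegral_Ioc_periodic {L : ℝ} (hL : 0 < L) {f : ℝ → ℝ≥0∞}
    (hf : Function.Periodic f L) (a : ℝ) :
    ∫⁻ x in Ioc a (a + L), f x = ∫⁻ x in Ioc 0 L, f x := by
  have h0 := isAddFundamentalDomain_Ioc hL 0
  rw [zero_add] at h0
  exact (isAddFundamentalDomain_Ioc hL a).setLIntegral_eq h0 f hf.map_vadd_zmultiples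

theorem setLIntegral_Ioc_periodic_sub_right {L : ℝ} (hL : 0 < L) {f : ℝ → ℝ≥0∞}
    (hf : Function.Periodic f L) (c : ℝ) :
    ∫⁻ x in Ioc 0 L, f (x - c) = ∫⁻ x in Ioc 0 L, f x := by
  have h := (measurePreserving_sub_right volume c).setLIntegral_comp_preimage_emb
    (measurableEmbedding_subRight c) f (Ioc (-c) (-c + L))
  rw [setLIntegral_Ioc_periodic hL hf] at h
  rw [← h]
  congr 2
  ext x
  simp only [mem_preimage, mem_Ioc]
  constructor <;> rintro ⟨h1, h2⟩ <;> constructor <;> linarith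

theorem setLIntegral_Ioc_periodic_sub_left {L : ℝ} (hL : 0 < L) {f : ℝ → ℝ≥0∞}
    (hf : Function.Periodic f L) (a c : ℝ) :
    ∫⁻ x in Ioc a (a + L), f (c - x) = ∫⁻ x in Ioc 0 L, f x := by
  have h := (Measure.measurePreserving_sub_left volume c).setLIntegral_comp_preimage_emb
    (measurableEmbedding_subLeft c) f (Ioc (c - a - L) (c - a - L + L))
  rw [setLIntegral_Ioc_periodic hL hf] at h
  -- Reflection exchanges the closed and open ends of the interval.
  rw [← h, ← setLIntegral_congr Ico_ae_eq_Ioc]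
  have : (fun x => c - x) ⁻¹' Ioc (c - a - L) (c - a - L + L) = Ico a (a + L) := by
    ext x
    simp only [mem_preimage, mem_Ioc, mem_Ico]
    constructor <;> rintro ⟨h1, h2⟩ <;> constructor <;> linarith
  rw [this]

end Periodic

/-! ### The singular kernel on the circle. -/

section Kernel

/-- The kernel `|t|_{ℝ / Lℤ}^{-q}`. -/
def circKernel (L q t : ℝ) : ℝ≥0∞ := (ENNReal.ofReal ‖(t : AddCircle L)‖ ^ q)⁻¹

/-- The kernel `|t|_{ℝ / Lℤ}^{-q}`, cut off at periodic distance `r`. -/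
def circKernelNear (L q r t : ℝ) : ℝ≥0∞ :=
  if ‖(t : AddCircle L)‖ ≤ r then circKernel L q t else 0

theorem measurable_norm_addCircle_coe (L : ℝ) : Measurable fun t : ℝ => ‖(t : AddCircle L)‖ :=
  (continuous_norm.comp (AddCircle.continuous_mk' L)).measurable

theorem measurable_circKernel (L q : ℝ) : Measurable (circKernel L q) :=
  ((measurable_norm_addCircle_coe L).ennreal_ofReal.pow_const q).inv

theorem measurable_circKernelNear (L q r : ℝ) : Measurable (circKernelNear L q r) :=
  Measurable.ite (measurableSet_le (measurable_norm_addCircle_coe L) measurable_const)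
    (measurable_circKernel L q) measurable_const

theorem circKernel_periodic (L q : ℝ) : Function.Periodic (circKernel L q) L := fun t => by
  simp [circKernel]

theorem circKernelNear_periodic (L q r : ℝ) : Function.Periodic (circKernelNear L q r) L :=
  fun t => by simp [circKernelNear, circKernel]

theorem norm_addCircle_coe_le (L t : ℝ) : ‖(t : AddCircle L)‖ ≤ |t| := by
  simpa using QuotientAddGroup.norm_mk_le_norm (S := AddSubgroup.zmultiples L) (m := t)

/-- Lets the kernel be inserted into an integral over a range of size `r`, at the price of the
factor `r ^ q`; this is how small powers of `ε` arise. -/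
theorem one_le_mul_circKernel {L q r t : ℝ} (hq : 0 ≤ q) (hr : 0 < r) (ht : |t| ≤ r) :
    1 ≤ ENNReal.ofReal r ^ q * circKernel L q t := by
  have hle : ENNReal.ofReal ‖(t : AddCircle L)‖ ^ q ≤ ENNReal.ofReal r ^ q :=
    ENNReal.rpow_le_rpow (ENNReal.ofReal_le_ofReal ((norm_addCircle_coe_le L t).trans ht)) hq
  have h0 : ENNReal.ofReal r ^ q ≠ 0 := by
    simp [ENNReal.rpow_eq_zero_iff, hr]
  have ht : ENNReal.ofReal r ^ q ≠ ⊤ := ENNReal.rpow_ne_top_of_nonneg hq ENNReal.ofReal_ne_top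
  rw [circKernel, ← div_eq_mul_inv, ENNReal.le_div_iff_mul_le (Or.inr h0) (Or.inr ht), one_mul]
  exact hle

theorem circKernelNear_of_abs_le {L q r t : ℝ} (ht : |t| ≤ r) :
    circKernelNear L q r t = circKernel L q t :=
  if_pos ((norm_addCircle_coe_le L t).trans ht)

theorem circKernelNear_le (L q r t : ℝ) : circKernelNear L q r t ≤ circKernel L q t := by
  unfold circKernelNear
  split_ifs <;> simp

variable {E : Type*} [NormedAddCommGroup E]

theorem gagliardo_eq_kernel (L s ρ : ℝ) (f : ℝ → E) :
    gagliardo L s ρ f = ∫⁻ x in Ioc 0 L, ∫⁻ y in Ioc 0 L,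
      ‖f x - f y‖ₑ ^ ρ * circKernel L (1 + s * ρ) (x - y) := rfl

theorem gagliardo_congr_ae (L s ρ : ℝ) {f g : ℝ → E} (h : f =ᵐ[volume] g) :
    gagliardo L s ρ f = gagliardo L s ρ g := by
  have h' := ae_restrict_of_ae (s := Ioc 0 L) h
  refine lintegral_congr_ae ?_
  filter_upwards [h'] with x hx
  refine lintegral_congr_ae ?_
  filter_upwards [h'] with y hy
  rw [hx, hy]

theorem measurable_enorm_sub_rpow {f : ℝ → E} (hf : StronglyMeasurable f) (ρ : ℝ) :
    Measurable fun p : ℝ × ℝ => ‖f p.1 - f p.2‖ₑ ^ ρ :=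
  (((hf.comp_measurable measurable_fst).sub
    (hf.comp_measurable measurable_snd)).enorm).pow_const ρ

theorem gagliardo_eq_prod (L s ρ : ℝ) {f : ℝ → E} (hf : StronglyMeasurable f) :
    gagliardo L s ρ f = ∫⁻ p, ‖f p.1 - f p.2‖ₑ ^ ρ * circKernel L (1 + s * ρ) (p.1 - p.2)
      ∂((volume.restrict (Ioc 0 L)).prod (volume.restrict (Ioc 0 L))) := by
  rw [gagliardo_eq_kernel, lintegral_prod]
  exact ((measurable_enorm_sub_rpow hf ρ).mul
    ((measurable_circKernel L _).comp (measurable_fst.sub measurable_snd))).aemeasurable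

end Kernel

/-! ### Averages of a periodic unit field. -/

section Average

variable {E : Type*} [NormedAddCommGroup E] [NormedSpace ℝ E]

/-- An everywhere defined representative of a periodic unit tangent field. -/
structure IsUnitPeriodic {F : Type*} [NormedAddCommGroup F] (L : ℝ) (u : ℝ → F) : Prop where
  stronglyMeasurable : StronglyMeasurable u
  periodic : Function.Periodic u L
  norm_eq_one : ∀ x, ‖u x‖ = 1

theorem IsUnitPeriodic.stronglyMeasurable_sub_left {F : Type*} [NormedAddCommGroup F]
    {L : ℝ} {u : ℝ → F} (hu : IsUnitPeriodic L u) (x : ℝ) :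
    StronglyMeasurable fun y => u (x - y) :=
  hu.stronglyMeasurable.comp_measurable (measurable_const.sub measurable_id)

theorem IsUnitPeriodic.integrable_sub_left {F : Type*} [NormedAddCommGroup F]
    {L : ℝ} {u : ℝ → F} {ν : Measure ℝ} [IsProbabilityMeasure ν] (hu : IsUnitPeriodic L u) (x : ℝ) :
    Integrable (fun y => u (x - y)) ν :=
  Integrable.of_bound (hu.stronglyMeasurable_sub_left x).aestronglyMeasurable 1
    (Eventually.of_forall fun _ => (hu.norm_eq_one _).le)

/-- The average `∫ u(x - y) dν(y)` of translates of `u`. -/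
def avg (ν : Measure ℝ) (u : ℝ → E) (x : ℝ) : E := ∫ y, u (x - y) ∂ν

theorem enorm_integral_rpow_le {α : Type*} [MeasurableSpace α] (ν : Measure α)
    [IsProbabilityMeasure ν] {f : α → E} (hf : AEStronglyMeasurable f ν) {ρ : ℝ} (hρ : 1 ≤ ρ) :
    ‖∫ y, f y ∂ν‖ₑ ^ ρ ≤ ∫⁻ y, ‖f y‖ₑ ^ ρ ∂ν := by
  have hρ0 : 0 < ρ := by linarith
  have h1 := eLpNorm_le_eLpNorm_of_exponent_le (μ := ν) (p := 1) (q := ENNReal.ofReal ρ)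
    (by simpa using hρ) hf
  rw [eLpNorm_one_eq_lintegral_enorm, eLpNorm_eq_lintegral_rpow_enorm_toReal (by simpa using hρ0)
    ENNReal.ofReal_ne_top, ENNReal.toReal_ofReal hρ0.le] at h1
  calc ‖∫ y, f y ∂ν‖ₑ ^ ρ ≤ ((∫⁻ y, ‖f y‖ₑ ^ ρ ∂ν) ^ (1 / ρ)) ^ ρ :=
        ENNReal.rpow_le_rpow ((enorm_integral_le_lintegral_enorm f).trans h1) hρ0.le
    _ = _ := by rw [← ENNReal.rpow_mul, one_div_mul_cancel hρ0.ne', ENNReal.rpow_one]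

variable {L : ℝ} {u : ℝ → E} {ν : Measure ℝ}

theorem IsUnitPeriodic.norm_avg_le_one [IsProbabilityMeasure ν] (hu : IsUnitPeriodic L u)
    (x : ℝ) : ‖avg ν u x‖ ≤ 1 := by
  have := norm_integral_le_of_norm_le_const (μ := ν) (f := fun y => u (x - y)) (C := 1)
    (Eventually.of_forall fun _ => (hu.norm_eq_one _).le)
  simpa [avg] using this

theorem IsUnitPeriodic.avg_periodic (hu : IsUnitPeriodic L u) :
    Function.Periodic (avg ν u) L := fun x => by
  simp only [avg]
  refine integral_congr_ae (Eventually.of_forall fun y => ?_)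
  have := hu.periodic (x - y)
  simpa [sub_add_eq_add_sub] using this

theorem IsUnitPeriodic.enorm_sub_avg_rpow_le [CompleteSpace E] [IsProbabilityMeasure ν]
    (hu : IsUnitPeriodic L u) {ρ : ℝ} (hρ : 1 ≤ ρ) (c : E) (x : ℝ) :
    ‖c - avg ν u x‖ₑ ^ ρ ≤ ∫⁻ y, ‖c - u (x - y)‖ₑ ^ ρ ∂ν := by
  have h : c - avg ν u x = ∫ y, (c - u (x - y)) ∂ν := by
    rw [integral_sub (integrable_const c) (hu.integrable_sub_left x)]
    simp [avg]
  rw [h]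
  exact enorm_integral_rpow_le ν
    (stronglyMeasurable_const.sub (hu.stronglyMeasurable_sub_left x)).aestronglyMeasurable hρ

theorem IsUnitPeriodic.enorm_avg_sub_avg_rpow_le [IsProbabilityMeasure ν]
    (hu : IsUnitPeriodic L u) {ρ : ℝ} (hρ : 1 ≤ ρ) (x y : ℝ) :
    ‖avg ν u x - avg ν u y‖ₑ ^ ρ ≤ ∫⁻ z, ‖u (x - z) - u (y - z)‖ₑ ^ ρ ∂ν := by
  rw [avg, avg, ← integral_sub (hu.integrable_sub_left x) (hu.integrable_sub_left y)]
  exact enorm_integral_rpow_le ν ((hu.stronglyMeasurable_sub_left x).sub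
    (hu.stronglyMeasurable_sub_left y)).aestronglyMeasurable hρ

/-- Averaging does not increase the Gagliardo seminorm. -/
theorem IsUnitPeriodic.gagliardo_avg_le [IsProbabilityMeasure ν] (hL : 0 < L)
    (hu : IsUnitPeriodic L u) {s ρ : ℝ} (hρ : 1 ≤ ρ) :
    gagliardo L s ρ (avg ν u) ≤ gagliardo L s ρ u := by
  set μ : Measure ℝ := volume.restrict (Ioc 0 L)
  set k := circKernel L (1 + s * ρ)
  have hk : Measurable k := measurable_circKernel _ _
  let P : ℝ × ℝ → ℝ≥0∞ := fun p => ‖u p.1 - u p.2‖ₑ ^ ρ * k (p.1 - p.2)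
  have hP : Measurable P := (measurable_enorm_sub_rpow hu.stronglyMeasurable ρ).mul
    (hk.comp (measurable_fst.sub measurable_snd))
  have hshift : Measurable fun q : (ℝ × ℝ) × ℝ => P (q.1.1 - q.2, q.1.2 - q.2) :=
    hP.comp (((measurable_fst.comp measurable_fst).sub measurable_snd).prodMk
      ((measurable_snd.comp measurable_fst).sub measurable_snd))
  calc gagliardo L s ρ (avg ν u)
      -- Jensen bounds the seminorm by an average of seminorms of translates, as the kernel depends
      -- only on `x - y`; Tonelli and periodicity then make every translate contribute equally.
      ≤ ∫⁻ x, ∫⁻ y, ∫⁻ z, P (x - z, y - z) ∂ν ∂μ ∂μ := by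
        rw [gagliardo_eq_kernel]
        refine lintegral_mono fun x => lintegral_mono fun y => ?_
        calc _ ≤ (∫⁻ z, ‖u (x - z) - u (y - z)‖ₑ ^ ρ ∂ν) * k (x - y) := by
              gcongr
              exact hu.enorm_avg_sub_avg_rpow_le hρ x y
          _ = ∫⁻ z, P (x - z, y - z) ∂ν := by
              rw [← lintegral_mul_const]
              · simp [P]
              · exact (((hu.stronglyMeasurable_sub_left x).sub
                  (hu.stronglyMeasurable_sub_left y)).enorm).pow_const ρ
    _ = ∫⁻ p, ∫⁻ z, P (p.1 - z, p.2 - z) ∂ν ∂(μ.prod μ) := by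
        rw [lintegral_prod]
        exact (Measurable.lintegral_prod_right' hshift).aemeasurable
    _ = ∫⁻ z, ∫⁻ p, P (p.1 - z, p.2 - z) ∂(μ.prod μ) ∂ν :=
        lintegral_lintegral_swap hshift.aemeasurable
    _ = ∫⁻ _, gagliardo L s ρ u ∂ν := by
        refine lintegral_congr fun z => ?_
        rw [lintegral_prod (fun p : ℝ × ℝ => P (p.1 - z, p.2 - z))
          (hP.comp ((measurable_fst.sub measurable_const).prodMk
          (measurable_snd.sub measurable_const))).aemeasurable, gagliardo_eq_kernel]
        have h1 : ∀ x, ∫⁻ y in Ioc 0 L, P (x - z, y - z) = ∫⁻ y in Ioc 0 L, P (x - z, y) :=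
          fun x => setLIntegral_Ioc_periodic_sub_right hL (f := fun y => P (x - z, y))
            (fun y => by
              have : x - z - (y + L) = x - z - y - L := by ring
              simp only [P, hu.periodic y, this, (circKernel_periodic L (1 + s * ρ)).sub_eq, k]) z
        simp only [μ, h1]
        refine setLIntegral_Ioc_periodic_sub_right hL
          (f := fun x => ∫⁻ y in Ioc 0 L, P (x, y)) (fun x => ?_) z
        refine lintegral_congr fun y => ?_
        have : x + L - y = x - y + L := by ring
        simp only [P, hu.periodic x, this, circKernel_periodic L (1 + s * ρ) _, k]
    _ = gagliardo L s ρ u := by simp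

/-- The average of a unit field against a measure concentrated near the origin is close to the
field. -/
theorem IsUnitPeriodic.lintegral_avg_sub_rpow_le [CompleteSpace E] [IsProbabilityMeasure ν]
    (hL : 0 < L) (hu : IsUnitPeriodic L u) {s ρ ε : ℝ} (hρ : 1 ≤ ρ) (hq : 0 ≤ 1 + s * ρ)
    (hε : 0 < ε) (hεL : ε < L / 2) {C : ℝ≥0∞} (hν : ν ≤ C • volume.restrict (Icc (-ε) ε)) :
    ∫⁻ x in Ioc 0 L, ‖u x - avg ν u x‖ₑ ^ ρ ≤
      C * (ENNReal.ofReal ε ^ (1 + s * ρ) * gagliardo L s ρ u) := by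
  set k := circKernel L (1 + s * ρ)
  have hm : ∀ x, Measurable fun y => ‖u x - u y‖ₑ ^ ρ * k (x - y) := fun x =>
    (((stronglyMeasurable_const.sub hu.stronglyMeasurable).enorm).pow_const ρ).mul
      ((measurable_circKernel _ _).comp (measurable_const.sub measurable_id))
  have hx : ∀ x, ‖u x - avg ν u x‖ₑ ^ ρ ≤ C * (ENNReal.ofReal ε ^ (1 + s * ρ) *
      ∫⁻ y in Ioc 0 L, ‖u x - u y‖ₑ ^ ρ * k (x - y)) := fun x => by
    calc ‖u x - avg ν u x‖ₑ ^ ρ ≤ ∫⁻ y, ‖u x - u (x - y)‖ₑ ^ ρ ∂ν :=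
          hu.enorm_sub_avg_rpow_le hρ _ x
      _ ≤ C * ∫⁻ y in Icc (-ε) ε, ‖u x - u (x - y)‖ₑ ^ ρ := by
          rw [← smul_eq_mul, ← lintegral_smul_measure]
          exact lintegral_mono' hν le_rfl
      _ ≤ C * ∫⁻ y in Icc (-ε) ε, ENNReal.ofReal ε ^ (1 + s * ρ) *
            (‖u x - u (x - y)‖ₑ ^ ρ * k (x - (x - y))) := by
          refine mul_le_mul_right (setLIntegral_mono' measurableSet_Icc fun y hy => ?_) C
          have := one_le_mul_circKernel (L := L) hq hε (abs_le.2 hy)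
          calc ‖u x - u (x - y)‖ₑ ^ ρ = ‖u x - u (x - y)‖ₑ ^ ρ * 1 := by rw [mul_one]
            _ ≤ ‖u x - u (x - y)‖ₑ ^ ρ * (ENNReal.ofReal ε ^ (1 + s * ρ) * k y) := by gcongr
            _ = _ := by rw [sub_sub_cancel]; ring
      -- As `ε < L / 2`, the window fits in one period, and by periodicity the integral becomes the
      -- inner integral of the seminorm.
      _ ≤ C * ∫⁻ y in Ioc (-(L / 2)) (-(L / 2) + L), ENNReal.ofReal ε ^ (1 + s * ρ) *
            (‖u x - u (x - y)‖ₑ ^ ρ * k (x - (x - y))) := by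
          gcongr
          exact fun y hy => ⟨by linarith [hy.1], by linarith [hy.2]⟩
      _ = _ := by
          rw [lintegral_const_mul]
          · congr 2
            refine setLIntegral_Ioc_periodic_sub_left hL
              (f := fun y => ‖u x - u y‖ₑ ^ ρ * k (x - y)) (fun y => ?_) _ x
            have : x - (y + L) = x - y - L := by ring
            simp only [hu.periodic y, this, (circKernel_periodic L (1 + s * ρ)).sub_eq, k]
          · exact (hm x).comp (measurable_const.sub measurable_id)
  refine (lintegral_mono hx).trans_eq ?_
  have hme : Measurable fun x => ∫⁻ y in Ioc 0 L, ‖u x - u y‖ₑ ^ ρ * k (x - y) :=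
    Measurable.lintegral_prod_right' (f := fun p : ℝ × ℝ =>
      ‖u p.1 - u p.2‖ₑ ^ ρ * k (p.1 - p.2))
      ((measurable_enorm_sub_rpow hu.stronglyMeasurable ρ).mul
      ((measurable_circKernel L _).comp (measurable_fst.sub measurable_snd)))
  rw [lintegral_const_mul _ (hme.const_mul _), lintegral_const_mul _ hme, gagliardo_eq_kernel]

/-- The part of the Gagliardo seminorm coming from pairs at periodic distance at most `r`. -/
def gagliardoNear {F : Type*} [NormedAddCommGroup F] (L s ρ : ℝ) (f : ℝ → F) (r : ℝ) : ℝ≥0∞ :=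
  ∫⁻ x in Ioc 0 L, ∫⁻ y in Ioc 0 L,
    ‖f x - f y‖ₑ ^ ρ * circKernelNear L (1 + s * ρ) r (x - y)

/-- Dominated convergence, with the full integrand as majorant: off the periodic diagonal the
cut-off kernel vanishes once `r` is below the distance. -/
theorem IsUnitPeriodic.tendsto_gagliardoNear {F : Type*} [NormedAddCommGroup F]
    {u : ℝ → F} (hu : IsUnitPeriodic L u) {s ρ : ℝ} (hρ : 0 < ρ)
    (hfin : gagliardo L s ρ u ≠ ⊤) :
    Tendsto (gagliardoNear L s ρ u) (𝓝[>] 0) (𝓝 0) := by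
  have hm : ∀ r, Measurable fun p : ℝ × ℝ =>
      ‖u p.1 - u p.2‖ₑ ^ ρ * circKernelNear L (1 + s * ρ) r (p.1 - p.2) := fun r =>
    (measurable_enorm_sub_rpow hu.stronglyMeasurable ρ).mul
      ((measurable_circKernelNear L _ r).comp (measurable_fst.sub measurable_snd))
  have heq : gagliardoNear L s ρ u = fun r => ∫⁻ p, ‖u p.1 - u p.2‖ₑ ^ ρ *
      circKernelNear L (1 + s * ρ) r (p.1 - p.2)
      ∂((volume.restrict (Ioc 0 L)).prod (volume.restrict (Ioc 0 L))) := by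
    funext r
    rw [lintegral_prod _ (hm r).aemeasurable, gagliardoNear]
  rw [gagliardo_eq_prod L s ρ hu.stronglyMeasurable] at hfin
  rw [heq]
  have := tendsto_lintegral_filter_of_dominated_convergence
    (μ := (volume.restrict (Ioc 0 L)).prod (volume.restrict (Ioc 0 L))) (l := 𝓝[>] (0 : ℝ))
    (F := fun r p => ‖u p.1 - u p.2‖ₑ ^ ρ * circKernelNear L (1 + s * ρ) r (p.1 - p.2))
    (f := fun _ => 0) _ (Eventually.of_forall hm)
    (Eventually.of_forall fun r => Eventually.of_forall fun p =>
      mul_le_mul_right (circKernelNear_le L (1 + s * ρ) r (p.1 - p.2)) _) hfin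
    (Eventually.of_forall fun p => ?_)
  · simpa using this
  · by_cases hp : ((p.1 - p.2 : ℝ) : AddCircle L) = 0
    · obtain ⟨k, hk⟩ := (AddCircle.coe_eq_zero_iff L).1 hp
      have : u p.1 = u p.2 := by
        rw [← hu.periodic.zsmul k p.2, hk, add_sub_cancel]
      -- The kernel may be infinite here, but the numerator is `0 ^ ρ = 0` and `0 * ⊤ = 0`.
      simp [this, hρ]
    · have hpos : 0 < ‖((p.1 - p.2 : ℝ) : AddCircle L)‖ := norm_pos_iff.2 hp
      refine tendsto_const_nhds.congr' ?_
      filter_upwards [Ioo_mem_nhdsGT hpos] with r hr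
      rw [circKernelNear, if_neg (not_le.2 hr.2), mul_zero]

/-- Quantitative form of the fact that averages of a unit field of vanishing mean oscillation
have norm close to one. -/
theorem IsUnitPeriodic.one_sub_enorm_avg_rpow_le [CompleteSpace E] [IsProbabilityMeasure ν]
    (hL : 0 < L) (hu : IsUnitPeriodic L u) {s ρ ε : ℝ} (hρ : 1 ≤ ρ) (hq : 0 ≤ 1 + s * ρ)
    (hε : 0 < ε) (hεL : ε < L / 2) {C : ℝ≥0∞} (hν : ν ≤ C • volume.restrict (Icc (-ε) ε))
    (x : ℝ) :
    (1 - ‖avg ν u x‖ₑ) ^ ρ ≤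
      C * (C * (ENNReal.ofReal (2 * ε) ^ (1 + s * ρ) * gagliardoNear L s ρ u (2 * ε))) := by
  set k := circKernelNear L (1 + s * ρ) (2 * ε) with hk
  have hkm : Measurable k := measurable_circKernelNear _ _ _
  have hρ0 : 0 < ρ := by linarith
  have hin : Icc (-ε) ε ⊆ Ioc (-(L / 2)) (-(L / 2) + L) :=
    fun y hy => ⟨by linarith [hy.1], by linarith [hy.2]⟩
  -- Triangle inequality from `‖u (x - z)‖ = 1`, averaged over `z`.
  have h1 : (1 - ‖avg ν u x‖ₑ) ^ ρ ≤ ∫⁻ z, ‖u (x - z) - avg ν u x‖ₑ ^ ρ ∂ν := by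
    calc (1 - ‖avg ν u x‖ₑ) ^ ρ = ∫⁻ _, (1 - ‖avg ν u x‖ₑ) ^ ρ ∂ν := by simp
      _ ≤ _ := by
        refine lintegral_mono fun z => ENNReal.rpow_le_rpow ?_ hρ0.le
        rw [tsub_le_iff_right]
        have : ‖u (x - z)‖ₑ = 1 := by
          rw [← ofReal_norm, hu.norm_eq_one, ENNReal.ofReal_one]
        rw [← this]
        simpa using enorm_add_le (u (x - z) - avg ν u x) (avg ν u x)
  -- Both points lie within `ε` of `x`, hence the distance `2 * ε`. The averages over `y` and over
  -- `z` each cost one factor `C`.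
  have h2 : ∀ z ∈ Icc (-ε) ε, ‖u (x - z) - avg ν u x‖ₑ ^ ρ ≤
      C * (ENNReal.ofReal (2 * ε) ^ (1 + s * ρ) *
        ∫⁻ y in Ioc 0 L, ‖u (x - z) - u y‖ₑ ^ ρ * k (x - z - y)) := fun z hz => by
    calc ‖u (x - z) - avg ν u x‖ₑ ^ ρ ≤ ∫⁻ y, ‖u (x - z) - u (x - y)‖ₑ ^ ρ ∂ν :=
          hu.enorm_sub_avg_rpow_le hρ _ x
      _ ≤ C * ∫⁻ y in Icc (-ε) ε, ‖u (x - z) - u (x - y)‖ₑ ^ ρ := by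
          rw [← smul_eq_mul, ← lintegral_smul_measure]
          exact lintegral_mono' hν le_rfl
      _ ≤ C * ∫⁻ y in Icc (-ε) ε, ENNReal.ofReal (2 * ε) ^ (1 + s * ρ) *
            (‖u (x - z) - u (x - y)‖ₑ ^ ρ * k (x - z - (x - y))) := by
          refine mul_le_mul_right (setLIntegral_mono' measurableSet_Icc fun y hy => ?_) C
          have habs : |x - z - (x - y)| ≤ 2 * ε := by
            rw [abs_le]
            constructor <;> linarith [hy.1, hy.2, hz.1, hz.2]
          have := one_le_mul_circKernel (L := L) hq (by positivity) habs
          rw [← circKernelNear_of_abs_le habs, ← hk] at this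
          calc ‖u (x - z) - u (x - y)‖ₑ ^ ρ = ‖u (x - z) - u (x - y)‖ₑ ^ ρ * 1 := by rw [mul_one]
            _ ≤ ‖u (x - z) - u (x - y)‖ₑ ^ ρ *
                (ENNReal.ofReal (2 * ε) ^ (1 + s * ρ) * k (x - z - (x - y))) := by gcongr
            _ = _ := by ring
      _ ≤ C * ∫⁻ y in Ioc (-(L / 2)) (-(L / 2) + L), ENNReal.ofReal (2 * ε) ^ (1 + s * ρ) *
            (‖u (x - z) - u (x - y)‖ₑ ^ ρ * k (x - z - (x - y))) := by
          gcongr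
      _ = _ := by
          rw [lintegral_const_mul]
          · congr 2
            refine setLIntegral_Ioc_periodic_sub_left hL
              (f := fun y => ‖u (x - z) - u y‖ₑ ^ ρ * k (x - z - y)) (fun y => ?_) _ x
            have : x - z - (y + L) = x - z - y - L := by ring
            simp only [hu.periodic y, this, (circKernelNear_periodic L _ _).sub_eq, k]
          · exact (((stronglyMeasurable_const.sub
              (hu.stronglyMeasurable_sub_left x)).enorm).pow_const ρ).mul
              (hkm.comp (measurable_const.sub (measurable_const.sub measurable_id)))
  have hme : Measurable fun x => ∫⁻ y in Ioc 0 L, ‖u x - u y‖ₑ ^ ρ * k (x - y) :=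
    Measurable.lintegral_prod_right' (f := fun p : ℝ × ℝ =>
      ‖u p.1 - u p.2‖ₑ ^ ρ * k (p.1 - p.2))
      ((measurable_enorm_sub_rpow hu.stronglyMeasurable ρ).mul
      (hkm.comp (measurable_fst.sub measurable_snd)))
  have hme' : Measurable fun z => ∫⁻ y in Ioc 0 L, ‖u (x - z) - u y‖ₑ ^ ρ * k (x - z - y) :=
    hme.comp (measurable_const.sub measurable_id)
  calc (1 - ‖avg ν u x‖ₑ) ^ ρ ≤ C * ∫⁻ z in Icc (-ε) ε, ‖u (x - z) - avg ν u x‖ₑ ^ ρ := by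
        rw [← smul_eq_mul, ← lintegral_smul_measure]
        exact h1.trans (lintegral_mono' hν le_rfl)
    _ ≤ C * ∫⁻ z in Icc (-ε) ε, C * (ENNReal.ofReal (2 * ε) ^ (1 + s * ρ) *
        ∫⁻ y in Ioc 0 L, ‖u (x - z) - u y‖ₑ ^ ρ * k (x - z - y)) := by
        exact mul_le_mul_right (setLIntegral_mono' measurableSet_Icc h2) C
    _ ≤ C * ∫⁻ z in Ioc (-(L / 2)) (-(L / 2) + L), C * (ENNReal.ofReal (2 * ε) ^ (1 + s * ρ) *
        ∫⁻ y in Ioc 0 L, ‖u (x - z) - u y‖ₑ ^ ρ * k (x - z - y)) := by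
        gcongr
    _ = _ := by
        rw [lintegral_const_mul _ (hme'.const_mul _), lintegral_const_mul _ hme']
        congr 3
        refine setLIntegral_Ioc_periodic_sub_left hL
          (f := fun x => ∫⁻ y in Ioc 0 L, ‖u x - u y‖ₑ ^ ρ * k (x - y)) (fun x => ?_) _ x
        refine lintegral_congr fun y => ?_
        have : x + L - y = x - y + L := by ring
        simp only [hu.periodic x, this, circKernelNear_periodic L _ _ _, k]

end Average

/-! ### The mollifier as a probability measure, and limits as `ε → 0`. -/

section Mollifier

variable {E : Type*} [NormedAddCommGroup E] [NormedSpace ℝ E]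

/-- The probability measure with density `η_ε`. -/
def mollifierMeasure (η : ℝ → ℝ) (ε : ℝ) : Measure ℝ :=
  volume.withDensity fun y => ENNReal.ofReal (1 / ε * η (y / ε))

variable {η : ℝ → ℝ} {ε : ℝ}

theorem IsMollifier.eq_zero (hη : IsMollifier η) {x : ℝ} (hx : x ∉ Icc (-1 : ℝ) 1) : η x = 0 :=
  image_eq_zero_of_notMem_tsupport fun h => hx (hη.tsupport_subset h)

theorem IsMollifier.scaled_eq_zero (hη : IsMollifier η) (hε : 0 < ε) {x : ℝ}
    (hx : x ∉ Icc (-ε) ε) : 1 / ε * η (x / ε) = 0 := by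
  rw [hη.eq_zero, mul_zero]
  intro h
  apply hx
  have h1 := h.1
  have h2 := h.2
  rw [le_div_iff₀ hε] at h1
  rw [div_le_iff₀ hε] at h2
  exact ⟨by linarith, by linarith⟩

theorem IsMollifier.scaled_nonneg (hη : IsMollifier η) (hε : 0 < ε) (x : ℝ) :
    0 ≤ 1 / ε * η (x / ε) :=
  mul_nonneg (by positivity) (hη.nonneg _)

theorem IsMollifier.contDiff_scaled (hη : IsMollifier η) (ε : ℝ) :
    ContDiff ℝ ∞ fun x => 1 / ε * η (x / ε) :=
  contDiff_const.mul (hη.contDiff.comp (contDiff_id.div_const ε))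

theorem IsMollifier.hasCompactSupport_scaled (hη : IsMollifier η) (hε : 0 < ε) :
    HasCompactSupport fun x => 1 / ε * η (x / ε) :=
  HasCompactSupport.intro isCompact_Icc fun _ hx => hη.scaled_eq_zero hε hx

theorem IsMollifier.measurable_density (hη : IsMollifier η) (ε : ℝ) :
    Measurable fun y => ENNReal.ofReal (1 / ε * η (y / ε)) :=
  (hη.contDiff_scaled ε).continuous.measurable.ennreal_ofReal

theorem IsMollifier.isProbabilityMeasure (hη : IsMollifier η) (hε : 0 < ε) :
    IsProbabilityMeasure (mollifierMeasure η ε) := by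
  constructor
  rw [mollifierMeasure, withDensity_apply _ MeasurableSet.univ, Measure.restrict_univ,
    ← ofReal_integral_eq_lintegral_ofReal
      ((hη.contDiff_scaled ε).continuous.integrable_of_hasCompactSupport
        (hη.hasCompactSupport_scaled hε))
      (Eventually.of_forall (hη.scaled_nonneg hε)),
    integral_const_mul, Measure.integral_comp_div, hη.integral_eq_one]
  simp [abs_of_pos hε, hε.ne']

theorem IsMollifier.exists_bound (hη : IsMollifier η) : ∃ M, 0 ≤ M ∧ ∀ x, η x ≤ M := by
  obtain ⟨M, hM⟩ := hη.contDiff.continuous.bounded_above_of_compact_support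
    (HasCompactSupport.intro isCompact_Icc fun _ hx => hη.eq_zero hx)
  exact ⟨M, (norm_nonneg _).trans (hM 0), fun x => (le_abs_self _).trans (hM x)⟩

theorem IsMollifier.measure_le (hη : IsMollifier η) (hε : 0 < ε) {M : ℝ} (hM : ∀ x, η x ≤ M) :
    mollifierMeasure η ε ≤ ENNReal.ofReal (M / ε) • volume.restrict (Icc (-ε) ε) := by
  refine Measure.le_iff.2 fun S hS => ?_
  rw [mollifierMeasure, withDensity_apply _ hS, Measure.smul_apply, Measure.restrict_apply hS,
    smul_eq_mul, inter_comm, ← Measure.restrict_apply measurableSet_Icc,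
    ← lintegral_indicator_const measurableSet_Icc]
  refine lintegral_mono fun x => ?_
  by_cases hx : x ∈ Icc (-ε) ε
  · rw [indicator_of_mem hx]
    refine ENNReal.ofReal_le_ofReal ?_
    rw [one_div, inv_mul_eq_div]
    gcongr
    exact hM _
  · rw [hη.scaled_eq_zero hε hx]
    simp

theorem IsMollifier.mollify_eq_avg (hη : IsMollifier η) (hε : 0 < ε) (γ : ℝ → E) :
    mollify η γ ε = avg (mollifierMeasure η ε) γ := by
  funext x
  rw [mollify, convolution_def, avg, mollifierMeasure,
    integral_withDensity_eq_integral_toReal_smul (hη.measurable_density ε) (by simp)]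
  refine integral_congr_ae (Eventually.of_forall fun y => ?_)
  simp only [ContinuousLinearMap.lsmul_apply]
  rw [ENNReal.toReal_ofReal (hη.scaled_nonneg hε y)]

theorem IsMollifier.ae_mem_Icc (hη : IsMollifier η) (hε : 0 < ε) :
    ∀ᵐ y ∂(mollifierMeasure η ε), y ∈ Icc (-ε) ε := by
  obtain ⟨M, -, hM⟩ := hη.exists_bound
  have := Measure.absolutelyContinuous_of_le_smul (hη.measure_le hε hM)
  exact this.ae_le (ae_restrict_mem measurableSet_Icc)

theorem IsMollifier.continuous_avg (hη : IsMollifier η) (hε : 0 < ε) {u : ℝ → E}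
    (hu : LocallyIntegrable u volume) : Continuous (avg (mollifierMeasure η ε) u) := by
  rw [← hη.mollify_eq_avg hε]
  exact (hη.hasCompactSupport_scaled hε).continuous_convolution_left _
    (hη.contDiff_scaled ε).continuous hu

theorem IsMollifier.hasDerivAt_mollify [CompleteSpace E] (hη : IsMollifier η) (hε : 0 < ε)
    {γ u : ℝ → E} (h : IsWeakDeriv γ u) (x : ℝ) :
    HasDerivAt (mollify η γ ε) (avg (mollifierMeasure η ε) u x) x := by
  rw [← hη.mollify_eq_avg hε]
  exact h.hasDerivAt_convolution (hη.contDiff_scaled ε) (hη.hasCompactSupport_scaled hε) x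

theorem IsMollifier.mollify_periodic (hη : IsMollifier η) (hε : 0 < ε) {γ : ℝ → E} {L : ℝ}
    (hγ : Function.Periodic γ L) : Function.Periodic (mollify η γ ε) L := fun x => by
  rw [hη.mollify_eq_avg hε]
  simp only [avg]
  refine integral_congr_ae (Eventually.of_forall fun y => ?_)
  have := hγ (x - y)
  simpa [sub_add_eq_add_sub] using this

theorem IsMollifier.norm_mollify_sub_le [CompleteSpace E] (hη : IsMollifier η) (hε : 0 < ε)
    {γ : ℝ → E} (hγ : LocallyIntegrable γ volume) {A : Set ℝ} (hA : ∀ᵐ x, x ∈ A)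
    (hLip : ∀ x ∈ A, ∀ y ∈ A, ‖γ x - γ y‖ ≤ |x - y|) {x : ℝ} (hx : x ∈ A) :
    ‖mollify η γ ε x - γ x‖ ≤ ε := by
  have := hη.isProbabilityMeasure hε
  have hac : mollifierMeasure η ε ≪ volume := withDensity_absolutelyContinuous _ _
  have hae : ∀ᵐ y ∂(mollifierMeasure η ε), ‖γ (x - y) - γ x‖ ≤ ε := by
    have h1 : ∀ᵐ y, x - y ∈ A :=
      (Measure.measurePreserving_sub_left volume x).quasiMeasurePreserving.ae hA
    filter_upwards [hη.ae_mem_Icc hε, hac.ae_le h1] with y hy hyA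
    refine (hLip _ hyA _ hx).trans ?_
    rw [abs_le]
    constructor <;> linarith [hy.1, hy.2]
  have hmeas : AEStronglyMeasurable (fun y => γ (x - y)) (mollifierMeasure η ε) :=
    (hγ.aestronglyMeasurable.comp_quasiMeasurePreserving
      (Measure.measurePreserving_sub_left volume x).quasiMeasurePreserving).mono_ac hac
  have hint : Integrable (fun y => γ (x - y) - γ x) (mollifierMeasure η ε) :=
    Integrable.of_bound (hmeas.sub aestronglyMeasurable_const) ε hae
  have hint' : Integrable (fun y => γ (x - y)) (mollifierMeasure η ε) := by
    exact (hint.add (integrable_const (γ x))).congr (Eventually.of_forall fun y => by simp)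
  have heq : mollify η γ ε x - γ x = ∫ y, (γ (x - y) - γ x) ∂(mollifierMeasure η ε) := by
    rw [integral_sub hint' (integrable_const _), hη.mollify_eq_avg hε]
    simp [avg]
  rw [heq]
  simpa using norm_integral_le_of_norm_le_const hae

/-- The density bound `M / ε` against the gain `ε ^ (1 + s * ρ)` leaves `M * ε ^ (s * ρ)`. -/
theorem IsMollifier.tendsto_lintegral_avg_sub [CompleteSpace E] (hη : IsMollifier η) {L s ρ : ℝ}
    (hL : 0 < L) (hs : 0 < s) (hρ : 1 ≤ ρ) {u : ℝ → E} (hu : IsUnitPeriodic L u)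
    (hfin : gagliardo L s ρ u ≠ ⊤) :
    Tendsto (fun ε => ∫⁻ x in Ioc 0 L, ‖u x - avg (mollifierMeasure η ε) u x‖ₑ ^ ρ)
      (𝓝[>] 0) (𝓝 0) := by
  obtain ⟨M, hM0, hM⟩ := hη.exists_bound
  have hsρ : 0 < s * ρ := by positivity
  have hlim : Tendsto (fun ε : ℝ => ENNReal.ofReal (M * ε ^ (s * ρ)) * gagliardo L s ρ u)
      (𝓝[>] 0) (𝓝 0) := by
    have h1 : Tendsto (fun ε : ℝ => M * ε ^ (s * ρ)) (𝓝[>] 0) (𝓝 0) := by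
      have := ((Real.continuousAt_rpow_const 0 (s * ρ) (Or.inr hsρ.le)).tendsto.mono_left
        (nhdsWithin_le_nhds (s := Ioi 0))).const_mul M
      simpa [Real.zero_rpow hsρ.ne'] using this
    have := ENNReal.Tendsto.mul_const (ENNReal.tendsto_ofReal h1)
      (Or.inr hfin) (b := gagliardo L s ρ u)
    simpa using this
  refine tendsto_of_tendsto_of_tendsto_of_le_of_le' tendsto_const_nhds hlim
    (Eventually.of_forall fun _ => zero_le) ?_
  filter_upwards [Ioo_mem_nhdsGT (show 0 < L / 2 by positivity)] with ε hε
  have := hη.isProbabilityMeasure hε.1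
  refine (hu.lintegral_avg_sub_rpow_le (s := s) hL hρ (by positivity) hε.1 hε.2
    (hη.measure_le hε.1 hM)).trans_eq ?_
  rw [← mul_assoc, ENNReal.ofReal_rpow_of_pos hε.1, 
    ← ENNReal.ofReal_mul (div_nonneg hM0 hε.1.le)]
  congr 2
  rw [Real.rpow_add hε.1, Real.rpow_one]
  have := hε.1.ne'
  field_simp

/-- Here `1 ≤ s * ρ` is decisive: `(M / ε) ^ 2 * (2 * ε) ^ (1 + s * ρ)` stays bounded. In the
critical case `s * ρ = 1` it does not tend to 0, and smallness comes entirely from the near-diagonal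
part of the seminorm. -/
theorem IsMollifier.eventually_le_norm_avg [CompleteSpace E] (hη : IsMollifier η) {L s ρ : ℝ}
    (hL : 0 < L) (hρ : 1 ≤ ρ) (hsρ : 1 ≤ s * ρ) {u : ℝ → E}
    (hu : IsUnitPeriodic L u) (hfin : gagliardo L s ρ u ≠ ⊤) {θ : ℝ} (hθ : θ < 1) :
    ∀ᶠ ε in 𝓝[>] (0 : ℝ), ∀ x, θ ≤ ‖avg (mollifierMeasure η ε) u x‖ := by
  obtain ⟨M, hM0, hM⟩ := hη.exists_bound
  have hρ0 : 0 < ρ := by linarith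
  have hpos : 0 < ENNReal.ofReal (1 - θ) ^ ρ :=
    ENNReal.rpow_pos (by simpa using hθ) ENNReal.ofReal_ne_top
  have hlim : Tendsto (fun ε : ℝ => ENNReal.ofReal (M ^ 2 * 2 ^ (1 + s * ρ)) *
      gagliardoNear L s ρ u (2 * ε)) (𝓝[>] 0) (𝓝 0) := by
    have h2 : Tendsto (fun ε : ℝ => 2 * ε) (𝓝[>] 0) (𝓝[>] 0) := by
      refine tendsto_nhdsWithin_iff.2 ⟨?_, ?_⟩
      · have : Tendsto (fun ε : ℝ => 2 * ε) (𝓝 0) (𝓝 (2 * 0)) := tendsto_id.const_mul 2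
        rw [mul_zero] at this
        exact this.mono_left nhdsWithin_le_nhds
      · filter_upwards [self_mem_nhdsWithin] with ε hε
        exact mul_pos two_pos (mem_Ioi.1 hε)
    have := ENNReal.Tendsto.const_mul ((hu.tendsto_gagliardoNear hρ0 hfin).comp h2)
      (a := ENNReal.ofReal (M ^ 2 * 2 ^ (1 + s * ρ))) (Or.inr ENNReal.ofReal_ne_top)
    simpa using this
  filter_upwards [Ioo_mem_nhdsGT (show 0 < L / 2 by positivity), Ioo_mem_nhdsGT one_pos,
    hlim.eventually (gt_mem_nhds hpos)] with ε hε hε1 hlt x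
  have hprob := hη.isProbabilityMeasure hε.1
  have hε0 := hε.1
  have h1 := hu.one_sub_enorm_avg_rpow_le (s := s) hL hρ (by positivity) hε.1 hε.2
    (hη.measure_le hε.1 hM) x
  have hconst : ENNReal.ofReal (M / ε) * (ENNReal.ofReal (M / ε) *
      ENNReal.ofReal (2 * ε) ^ (1 + s * ρ)) ≤ ENNReal.ofReal (M ^ 2 * 2 ^ (1 + s * ρ)) := by
    rw [ENNReal.ofReal_rpow_of_pos (by positivity), ← ENNReal.ofReal_mul (by positivity),
      ← ENNReal.ofReal_mul (by positivity)]
    refine ENNReal.ofReal_le_ofReal ?_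
    have h3 : ε ^ (1 + s * ρ) ≤ ε ^ (2 : ℝ) :=
      Real.rpow_le_rpow_of_exponent_ge hε0 hε1.2.le (by linarith)
    rw [Real.rpow_two] at h3
    rw [Real.mul_rpow two_pos.le hε0.le]
    calc M / ε * (M / ε * (2 ^ (1 + s * ρ) * ε ^ (1 + s * ρ)))
        ≤ M / ε * (M / ε * (2 ^ (1 + s * ρ) * ε ^ 2)) := by gcongr
      _ = _ := by field_simp
  have h2 : (1 - ‖avg (mollifierMeasure η ε) u x‖ₑ) ^ ρ < ENNReal.ofReal (1 - θ) ^ ρ := by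
    refine (h1.trans ?_).trans_lt hlt
    calc _ = ENNReal.ofReal (M / ε) * (ENNReal.ofReal (M / ε) *
          ENNReal.ofReal (2 * ε) ^ (1 + s * ρ)) * gagliardoNear L s ρ u (2 * ε) := by ring
      _ ≤ _ := by gcongr
  rw [ENNReal.rpow_lt_rpow_iff hρ0, ← ofReal_norm, ← ENNReal.ofReal_one,
    ← ENNReal.ofReal_sub _ (norm_nonneg _), ENNReal.ofReal_lt_ofReal_iff (by linarith)] at h2
  linarith

end Mollifier

/-! ### Change of variables by arclength for a speed close to one. -/

section Speed

/-- A continuous periodic speed, of mean one over a period, with values in `[θ, θ⁻¹]`. -/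
structure IsSpeed (L θ : ℝ) (v : ℝ → ℝ) : Prop where
  continuous : Continuous v
  periodic : Function.Periodic v L
  pos : 0 < θ
  le : ∀ x, θ ≤ v x
  le_inv : ∀ x, v x ≤ θ⁻¹
  integral_eq : ∫ x in (0 : ℝ)..L, v x = L

/-- The travelled distance for a given speed. -/
def distanceOf (v : ℝ → ℝ) (x : ℝ) : ℝ := ∫ z in (0 : ℝ)..x, v z

variable {L θ : ℝ} {v : ℝ → ℝ}

theorem IsSpeed.hasDerivAt (hv : IsSpeed L θ v) (x : ℝ) : HasDerivAt (distanceOf v) (v x) x :=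
  (hv.continuous.integral_hasStrictDerivAt 0 x).hasDerivAt

theorem IsSpeed.distance_sub (hv : IsSpeed L θ v) (x y : ℝ) :
    distanceOf v y - distanceOf v x = ∫ z in x..y, v z :=
  intervalIntegral.integral_interval_sub_left (hv.continuous.intervalIntegrable _ _)
    (hv.continuous.intervalIntegrable _ _)

theorem IsSpeed.mul_sub_le (hv : IsSpeed L θ v) {x y : ℝ} (hxy : x ≤ y) :
    θ * (y - x) ≤ distanceOf v y - distanceOf v x := by
  rw [hv.distance_sub]
  have := intervalIntegral.integral_mono_on hxy (intervalIntegrable_const (c := θ))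
    (hv.continuous.intervalIntegrable (μ := volume) x y) fun z _ => hv.le z
  simpa [mul_comm] using this

theorem IsSpeed.mul_abs_sub_le (hv : IsSpeed L θ v) (x y : ℝ) :
    θ * |x - y| ≤ |distanceOf v x - distanceOf v y| := by
  rcases le_total x y with h | h
  · rw [abs_sub_comm, abs_of_nonneg (sub_nonneg.2 h), abs_sub_comm]
    exact (hv.mul_sub_le h).trans (le_abs_self _)
  · rw [abs_of_nonneg (sub_nonneg.2 h)]
    exact (hv.mul_sub_le h).trans (le_abs_self _)

theorem IsSpeed.strictMono (hv : IsSpeed L θ v) : StrictMono (distanceOf v) := fun x y h => by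
  have h1 := hv.mul_sub_le h.le
  have h2 := mul_pos hv.pos (sub_pos.2 h)
  linarith

theorem distanceOf_zero (v : ℝ → ℝ) : distanceOf v 0 = 0 := by simp [distanceOf]

theorem IsSpeed.distance_continuous (hv : IsSpeed L θ v) : Continuous (distanceOf v) :=
  continuous_iff_continuousAt.2 fun x => (hv.hasDerivAt x).continuousAt

theorem IsSpeed.bijective (hv : IsSpeed L θ v) : Function.Bijective (distanceOf v) := by
  refine ⟨hv.strictMono.injective, hv.distance_continuous.surjective ?_ ?_⟩
  · refine tendsto_atTop_mono' _ ?_ (tendsto_id.const_mul_atTop hv.pos)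
    filter_upwards [eventually_ge_atTop 0] with x hx
    simpa [distanceOf_zero] using hv.mul_sub_le hx
  · refine tendsto_atBot_mono' _ ?_ (tendsto_id.const_mul_atBot hv.pos)
    filter_upwards [eventually_le_atBot 0] with x hx
    have := hv.mul_sub_le hx
    rw [distanceOf_zero] at this
    simp only [id]
    linarith

theorem IsSpeed.distance_add_period (hv : IsSpeed L θ v) (x : ℝ) :
    distanceOf v (x + L) = distanceOf v x + L := by
  have h := hv.distance_sub x (x + L)
  rw [hv.periodic.intervalIntegral_add_eq x 0, zero_add, hv.integral_eq] at h
  linarith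

theorem IsSpeed.distance_period (hv : IsSpeed L θ v) : distanceOf v L = L := hv.integral_eq

theorem IsSpeed.distance_add_zsmul (hv : IsSpeed L θ v) (x : ℝ) (k : ℤ) :
    distanceOf v (x + k * L) = distanceOf v x + k * L := by
  have hp : Function.Periodic (fun x => distanceOf v x - x) L := fun x => by
    simp only [hv.distance_add_period]
    ring
  have := hp.int_mul k x
  linarith

/-- A shift of `y` by `k * L` shifts its travelled distance by the same amount, so the shift that
realizes the circle distance of the images reduces the claim to the line. -/
theorem IsSpeed.mul_norm_le (hv : IsSpeed L θ v) (x y : ℝ) :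
    θ * ‖((x - y : ℝ) : AddCircle L)‖ ≤
      ‖((distanceOf v x - distanceOf v y : ℝ) : AddCircle L)‖ := by
  rw [AddCircle.norm_eq (x := distanceOf v x - distanceOf v y)]
  set k := round (L⁻¹ * (distanceOf v x - distanceOf v y))
  have h1 : distanceOf v x - distanceOf v y - k * L =
      distanceOf v x - distanceOf v (y + k * L) := by
    rw [hv.distance_add_zsmul]
    ring
  rw [h1]
  refine le_trans ?_ (hv.mul_abs_sub_le _ _)
  refine mul_le_mul_of_nonneg_left ?_ hv.pos.le
  have h2 : ((x - y : ℝ) : AddCircle L) = ((x - (y + k * L) : ℝ) : AddCircle L) := by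
    rw [← sub_sub, AddCircle.coe_sub (p := L) (x - y)]
    have : ((k * L : ℝ) : AddCircle L) = 0 :=
      (AddCircle.coe_eq_zero_iff L).2 ⟨k, by simp⟩
    rw [this, sub_zero]
  rw [h2]
  exact norm_addCircle_coe_le _ _

theorem IsSpeed.circKernel_le (hv : IsSpeed L θ v) {q : ℝ} (hq : 0 ≤ q) (x y : ℝ) :
    circKernel L q (distanceOf v x - distanceOf v y) ≤
      ENNReal.ofReal (θ⁻¹ ^ q) * circKernel L q (x - y) := by
  have h1 : ENNReal.ofReal (θ⁻¹ ^ q) = (ENNReal.ofReal θ ^ q)⁻¹ := by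
    rw [← ENNReal.ofReal_rpow_of_pos (inv_pos.2 hv.pos), ENNReal.ofReal_inv_of_pos hv.pos,
      ENNReal.inv_rpow]
  have h2 : ENNReal.ofReal θ ^ q ≠ 0 := by
    simp [ENNReal.rpow_eq_zero_iff, hv.pos]
  have h3 : ENNReal.ofReal θ ^ q ≠ ⊤ := ENNReal.rpow_ne_top_of_nonneg hq ENNReal.ofReal_ne_top
  rw [h1, circKernel, circKernel, ← ENNReal.mul_inv (Or.inl h2) (Or.inl h3), ENNReal.inv_le_inv,
    ← ENNReal.mul_rpow_of_nonneg _ _ hq, ← ENNReal.ofReal_mul hv.pos.le]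
  exact ENNReal.rpow_le_rpow (ENNReal.ofReal_le_ofReal (hv.mul_norm_le x y)) hq

/-- The time at which a given distance has been travelled. -/
def timeOf (v : ℝ → ℝ) : ℝ → ℝ := Function.invFun (distanceOf v)

theorem IsSpeed.distance_time (hv : IsSpeed L θ v) (t : ℝ) : distanceOf v (timeOf v t) = t :=
  Function.rightInverse_invFun hv.bijective.2 t

theorem IsSpeed.time_distance (hv : IsSpeed L θ v) (x : ℝ) : timeOf v (distanceOf v x) = x :=
  Function.leftInverse_invFun hv.bijective.1 x

theorem IsSpeed.time_zero (hv : IsSpeed L θ v) : timeOf v 0 = 0 := by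
  have := hv.time_distance 0
  rwa [distanceOf_zero] at this

theorem IsSpeed.time_continuous (hv : IsSpeed L θ v) : Continuous (timeOf v) := by
  have : LipschitzWith (Real.toNNReal θ⁻¹) (timeOf v) := by
    refine LipschitzWith.of_dist_le_mul fun x y => ?_
    have h := hv.mul_abs_sub_le (timeOf v x) (timeOf v y)
    rw [hv.distance_time, hv.distance_time] at h
    rw [Real.dist_eq, Real.dist_eq, Real.coe_toNNReal _ (inv_pos.2 hv.pos).le,
      inv_mul_eq_div, le_div_iff₀ hv.pos, mul_comm]
    exact h
  exact this.continuous

theorem IsSpeed.hasDerivAt_time (hv : IsSpeed L θ v) (t : ℝ) :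
    HasDerivAt (timeOf v) (v (timeOf v t))⁻¹ t :=
  (hv.hasDerivAt (timeOf v t)).of_local_left_inverse hv.time_continuous.continuousAt
    (hv.pos.trans_le (hv.le _)).ne' (Eventually.of_forall hv.distance_time)

theorem IsSpeed.time_add_period (hv : IsSpeed L θ v) (t : ℝ) :
    timeOf v (t + L) = timeOf v t + L := by
  apply hv.bijective.1
  rw [hv.distance_time, hv.distance_add_period, hv.distance_time]

theorem IsSpeed.abs_sub_one_le (hv : IsSpeed L θ v) (x : ℝ) : |v x - 1| ≤ θ⁻¹ - 1 := by
  have h1 := hv.le x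
  have h2 := hv.le_inv x
  have h3 : 0 < θ := hv.pos
  -- This is `θ + θ⁻¹ ≥ 2`.
  have h4 : 1 - θ ≤ θ⁻¹ - 1 := by
    have : θ * θ⁻¹ = 1 := mul_inv_cancel₀ h3.ne'
    have h5 : 0 < θ⁻¹ := inv_pos.2 h3
    nlinarith [sq_nonneg (θ - 1)]
  rw [abs_le]
  constructor <;> linarith

theorem IsSpeed.mapsTo_time (hv : IsSpeed L θ v) {t : ℝ} (ht : t ∈ Ioc 0 L) :
    timeOf v t ∈ Ioc 0 L := by
  constructor
  · rw [← hv.strictMono.lt_iff_lt, hv.distance_time, distanceOf_zero]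
    exact ht.1
  · rw [← hv.strictMono.le_iff_le, hv.distance_time, hv.distance_period]
    exact ht.2

theorem IsSpeed.abs_time_sub_le (hv : IsSpeed L θ v) {t : ℝ} (ht : t ∈ Ioc 0 L) :
    |timeOf v t - t| ≤ (θ⁻¹ - 1) * L := by
  have hx := hv.mapsTo_time ht
  set x := timeOf v t with hxdef
  have htx : t = distanceOf v x := (hv.distance_time t).symm
  have h1 : distanceOf v x - x = ∫ z in (0 : ℝ)..x, (v z - 1) := by
    rw [intervalIntegral.integral_sub (hv.continuous.intervalIntegrable _ _)
      intervalIntegrable_const]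
    simp [distanceOf]
  have h2 := intervalIntegral.norm_integral_le_of_norm_le_const (a := 0) (b := x)
    (f := fun z => v z - 1) (C := θ⁻¹ - 1) fun z _ => hv.abs_sub_one_le z
  rw [← h1, sub_zero, abs_of_pos hx.1, Real.norm_eq_abs, ← htx, abs_sub_comm] at h2
  refine h2.trans (mul_le_mul_of_nonneg_left hx.2 ?_)
  exact (abs_nonneg _).trans (hv.abs_sub_one_le 0)

theorem IsSpeed.lintegral_comp_time (hv : IsSpeed L θ v) (F : ℝ → ℝ≥0∞) :
    ∫⁻ t in Ioc 0 L, F (timeOf v t) = ∫⁻ x in Ioc 0 L, ENNReal.ofReal (v x) * F x := by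
  have himg : distanceOf v '' Ioc 0 L = Ioc 0 L := by
    ext t
    constructor
    · rintro ⟨x, hx, rfl⟩
      have h1 := hv.strictMono hx.1
      have h2 := hv.strictMono.monotone hx.2
      rw [distanceOf_zero] at h1
      rw [hv.distance_period] at h2
      exact ⟨h1, h2⟩
    · exact fun ht => ⟨timeOf v t, hv.mapsTo_time ht, hv.distance_time t⟩
  have h := lintegral_image_eq_lintegral_abs_deriv_mul (s := Ioc 0 L) measurableSet_Ioc
    (fun x _ => (hv.hasDerivAt x).hasDerivWithinAt) hv.bijective.1.injOn
    (fun t => F (timeOf v t))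
  rw [himg] at h
  rw [h]
  refine lintegral_congr fun x => ?_
  rw [hv.time_distance, abs_of_pos (hv.pos.trans_le (hv.le x))]

theorem IsSpeed.lintegral_comp_time_le (hv : IsSpeed L θ v) (F : ℝ → ℝ≥0∞) :
    ∫⁻ t in Ioc 0 L, F (timeOf v t) ≤ ENNReal.ofReal θ⁻¹ * ∫⁻ x in Ioc 0 L, F x := by
  rw [hv.lintegral_comp_time, ← lintegral_const_mul' _ _ ENNReal.ofReal_ne_top]
  refine lintegral_mono fun x => ?_
  gcongr
  exact hv.le_inv x

/-- Each of the two integrations costs `θ⁻¹`, and the kernel costs `θ⁻¹ ^ (1 + s * ρ)`. The total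
tends to 1 as `θ → 1`. -/
theorem IsSpeed.gagliardo_comp_time_le {E : Type*} [NormedAddCommGroup E] (hv : IsSpeed L θ v)
    {s ρ : ℝ} (hq : 0 ≤ 1 + s * ρ) (f : ℝ → E) :
    gagliardo L s ρ (fun t => f (timeOf v t)) ≤
      ENNReal.ofReal (θ⁻¹ * (θ⁻¹ * θ⁻¹ ^ (1 + s * ρ))) * gagliardo L s ρ f := by
  set k := circKernel L (1 + s * ρ)
  have hθ : 0 ≤ θ⁻¹ := (inv_pos.2 hv.pos).le
  calc gagliardo L s ρ (fun t => f (timeOf v t))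
      -- Writing `t` as the distance at time `timeOf v t` makes the whole integrand a function of
      -- the two times.
      = ∫⁻ t in Ioc 0 L, ∫⁻ r in Ioc 0 L, ‖f (timeOf v t) - f (timeOf v r)‖ₑ ^ ρ *
          k (distanceOf v (timeOf v t) - distanceOf v (timeOf v r)) := by
        simp only [gagliardo_eq_kernel, hv.distance_time, k]
    _ ≤ ENNReal.ofReal θ⁻¹ * ∫⁻ x in Ioc 0 L, ∫⁻ r in Ioc 0 L,
          ‖f x - f (timeOf v r)‖ₑ ^ ρ * k (distanceOf v x - distanceOf v (timeOf v r)) :=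
        hv.lintegral_comp_time_le (fun x => ∫⁻ r in Ioc 0 L, ‖f x - f (timeOf v r)‖ₑ ^ ρ *
          k (distanceOf v x - distanceOf v (timeOf v r)))
    _ ≤ ENNReal.ofReal θ⁻¹ * ∫⁻ x in Ioc 0 L, ENNReal.ofReal θ⁻¹ * ∫⁻ y in Ioc 0 L,
          ‖f x - f y‖ₑ ^ ρ * k (distanceOf v x - distanceOf v y) := by
        refine mul_le_mul_right (lintegral_mono fun x => ?_) _
        exact hv.lintegral_comp_time_le (fun y => ‖f x - f y‖ₑ ^ ρ *
          k (distanceOf v x - distanceOf v y))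
    _ ≤ ENNReal.ofReal θ⁻¹ * ∫⁻ x in Ioc 0 L, ENNReal.ofReal θ⁻¹ * ∫⁻ y in Ioc 0 L,
          ENNReal.ofReal (θ⁻¹ ^ (1 + s * ρ)) * (‖f x - f y‖ₑ ^ ρ * k (x - y)) := by
        refine mul_le_mul_right (lintegral_mono fun x =>
          mul_le_mul_right (lintegral_mono fun y => ?_) _) _
        calc _ ≤ ‖f x - f y‖ₑ ^ ρ * (ENNReal.ofReal (θ⁻¹ ^ (1 + s * ρ)) * k (x - y)) :=
              mul_le_mul_right (hv.circKernel_le hq x y) _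
          _ = _ := by ring
    _ = _ := by
        simp only [lintegral_const_mul' _ _ ENNReal.ofReal_ne_top]
        rw [ENNReal.ofReal_mul hθ, ENNReal.ofReal_mul hθ, gagliardo_eq_kernel]
        ring

end Speed

/-! ### Normalization of vectors bounded away from zero. -/

section Normalize

variable {E : Type*} [NormedAddCommGroup E] [InnerProductSpace ℝ E]

/-- With `n`, `k` the unit vectors, `‖a - b‖² = (‖a‖ - ‖b‖)² + ‖a‖ ‖b‖ ‖n - k‖²`. The inner product
yields the constant `θ⁻¹`; the triangle inequality would lose a factor 2, and the constant must tend
to 1. -/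
theorem norm_normalize_sub_le {a b : E} {θ : ℝ} (hθ : 0 < θ) (ha : θ ≤ ‖a‖) (hb : θ ≤ ‖b‖) :
    ‖‖a‖⁻¹ • a - ‖b‖⁻¹ • b‖ ≤ θ⁻¹ * ‖a - b‖ := by
  have ha0 : 0 < ‖a‖ := hθ.trans_le ha
  have hb0 : 0 < ‖b‖ := hθ.trans_le hb
  set n := ‖a‖⁻¹ • a
  set k := ‖b‖⁻¹ • b
  have hn : ‖n‖ = 1 := by simp [n, norm_smul, ha0.ne']
  have hk : ‖k‖ = 1 := by simp [k, norm_smul, hb0.ne']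
  have han : a = ‖a‖ • n := by simp [n, smul_smul, ha0.ne']
  have hbk : b = ‖b‖ • k := by simp [k, smul_smul, hb0.ne']
  have h1 : ‖a - b‖ ^ 2 = (‖a‖ - ‖b‖) ^ 2 + ‖a‖ * ‖b‖ * ‖n - k‖ ^ 2 := by
    have e1 : ‖a - b‖ ^ 2 = ‖a‖ ^ 2 - 2 * inner ℝ a b + ‖b‖ ^ 2 := norm_sub_sq_real a b
    have e2 : ‖n - k‖ ^ 2 = ‖n‖ ^ 2 - 2 * inner ℝ n k + ‖k‖ ^ 2 := norm_sub_sq_real n k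
    have e3 : inner ℝ a b = ‖a‖ * (‖b‖ * inner ℝ n k) := by
      conv_lhs => rw [han, hbk]
      rw [real_inner_smul_left, real_inner_smul_right]
    rw [e1, e2, e3, hn, hk]
    ring
  have h2 : (θ * ‖n - k‖) ^ 2 ≤ ‖a - b‖ ^ 2 := by
    rw [h1, mul_pow]
    have : θ ^ 2 ≤ ‖a‖ * ‖b‖ := by nlinarith
    nlinarith [sq_nonneg (‖a‖ - ‖b‖), mul_le_mul_of_nonneg_right this (sq_nonneg ‖n - k‖)]
  have h3 : θ * ‖n - k‖ ≤ ‖a - b‖ := by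
    exact (pow_le_pow_iff_left₀ (by positivity) (norm_nonneg _) two_ne_zero).1 h2
  rw [inv_mul_eq_div, le_div_iff₀ hθ, mul_comm]
  exact h3

theorem gagliardo_normalize_le {L s ρ θ : ℝ} (hρ : 0 ≤ ρ) (hθ : 0 < θ) {f : ℝ → E}
    (hf : ∀ x, θ ≤ ‖f x‖) :
    gagliardo L s ρ (fun x => ‖f x‖⁻¹ • f x) ≤ ENNReal.ofReal (θ⁻¹ ^ ρ) * gagliardo L s ρ f := by
  simp only [gagliardo_eq_kernel, ← lintegral_const_mul' _ _ ENNReal.ofReal_ne_top]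
  refine lintegral_mono fun x => lintegral_mono fun y => ?_
  rw [← mul_assoc]
  gcongr
  rw [← ENNReal.ofReal_rpow_of_pos (inv_pos.2 hθ), ← ENNReal.mul_rpow_of_nonneg _ _ hρ]
  refine ENNReal.rpow_le_rpow ?_ hρ
  rw [← ofReal_norm, ← ofReal_norm, ← ENNReal.ofReal_mul (inv_pos.2 hθ).le]
  exact ENNReal.ofReal_le_ofReal (norm_normalize_sub_le hθ (hf x) (hf y))

end Normalize

/-! ### Strong convergence from pointwise convergence and control of norms. -/

section StrongConvergence

variable {E : Type*} [NormedAddCommGroup E]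

theorem enorm_add_rpow_le {ρ : ℝ} (hρ : 1 ≤ ρ) (a b : E) :
    ‖a + b‖ₑ ^ ρ ≤ 2 ^ (ρ - 1) * (‖a‖ₑ ^ ρ + ‖b‖ₑ ^ ρ) :=
  (ENNReal.rpow_le_rpow (enorm_add_le a b) (by linarith)).trans
    (ENNReal.rpow_add_le_mul_rpow_add_rpow _ _ hρ)

theorem lintegral_enorm_add_rpow_le {α : Type*} [MeasurableSpace α] {μ : Measure α} {f g : α → E}
    {ρ : ℝ} (hρ : 1 ≤ ρ) (hg : AEStronglyMeasurable g μ) :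
    ∫⁻ x, ‖f x + g x‖ₑ ^ ρ ∂μ ≤
      2 ^ (ρ - 1) * (∫⁻ x, ‖f x‖ₑ ^ ρ ∂μ + ∫⁻ x, ‖g x‖ₑ ^ ρ ∂μ) := by
  rw [← lintegral_add_right' _ (hg.enorm.pow_const ρ), ← lintegral_const_mul' _ _
    (ENNReal.rpow_ne_top_of_nonneg (by linarith) ENNReal.ofNat_ne_top)]
  exact lintegral_mono fun x => enorm_add_rpow_le hρ _ _

/-- Pointwise convergence together with an upper bound on the limit of the norms implies
strong convergence. -/
theorem tendsto_lintegral_enorm_sub_rpow {α : Type*} [MeasurableSpace α] {μ : Measure α}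
    {F : ℕ → α → E} {G : α → E} {ρ : ℝ} (hρ : 1 ≤ ρ)
    (hF : ∀ n, AEStronglyMeasurable (F n) μ) (hG : AEStronglyMeasurable G μ)
    (hae : ∀ᵐ x ∂μ, Tendsto (fun n => F n x) atTop (𝓝 (G x)))
    (hfin : ∫⁻ x, ‖G x‖ₑ ^ ρ ∂μ ≠ ⊤)
    (hle : ∀ B, ∫⁻ x, ‖G x‖ₑ ^ ρ ∂μ < B → ∀ᶠ n in atTop, ∫⁻ x, ‖F n x‖ₑ ^ ρ ∂μ ≤ B) :
    Tendsto (fun n => ∫⁻ x, ‖F n x - G x‖ₑ ^ ρ ∂μ) atTop (𝓝 0) := by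
  have hρ0 : 0 < ρ := by linarith
  set c : ℝ≥0∞ := 2 ^ (ρ - 1) with hc
  have hc0 : c ≠ 0 := by simp [hc, ENNReal.rpow_eq_zero_iff]
  have hct : c ≠ ⊤ := ENNReal.rpow_ne_top_of_nonneg (by linarith) ENNReal.ofNat_ne_top
  set A := ∫⁻ x, ‖G x‖ₑ ^ ρ ∂μ
  have hGm : AEMeasurable (fun x => ‖G x‖ₑ ^ ρ) μ := hG.enorm.pow_const ρ
  have hFm : ∀ n, AEMeasurable (fun x => ‖F n x‖ₑ ^ ρ) μ := fun n => (hF n).enorm.pow_const ρ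
  have hDm : ∀ n, AEMeasurable (fun x => ‖F n x - G x‖ₑ ^ ρ) μ := fun n =>
    ((hF n).sub hG).enorm.pow_const ρ
  -- By `hpt` the truncated subtraction loses nothing. Fatou for `H` bounds its integrals from
  -- below, hence those of `‖F n - G‖ ^ ρ` from above.
  let H : ℕ → α → ℝ≥0∞ := fun n x =>
    c * (‖F n x‖ₑ ^ ρ + ‖G x‖ₑ ^ ρ) - ‖F n x - G x‖ₑ ^ ρ
  have hpt : ∀ n x, ‖F n x - G x‖ₑ ^ ρ ≤ c * (‖F n x‖ₑ ^ ρ + ‖G x‖ₑ ^ ρ) := fun n x => by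
    have := enorm_add_rpow_le hρ (F n x) (-G x)
    rwa [← sub_eq_add_neg (F n x), enorm_neg] at this
  have hHm : ∀ n, AEMeasurable (H n) μ := fun n =>
    (((hFm n).add hGm).const_mul c).sub (hDm n)
  have hlim : ∀ᵐ x ∂μ, liminf (fun n => H n x) atTop = c * (‖G x‖ₑ ^ ρ + ‖G x‖ₑ ^ ρ) := by
    filter_upwards [hae] with x hx
    have hpow : Continuous fun a : ℝ≥0∞ => a ^ ρ := ENNReal.continuous_rpow_const
    have h1 : Tendsto (fun n => ‖F n x‖ₑ ^ ρ) atTop (𝓝 (‖G x‖ₑ ^ ρ)) :=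
      (hpow.tendsto _).comp hx.enorm
    have h2 : Tendsto (fun n => ‖F n x - G x‖ₑ ^ ρ) atTop (𝓝 0) := by
      have := (hpow.tendsto _).comp (hx.sub_const (G x)).enorm
      simpa [Function.comp_def, hρ0] using this
    have h3 : Tendsto (fun n => H n x) atTop (𝓝 (c * (‖G x‖ₑ ^ ρ + ‖G x‖ₑ ^ ρ) - 0)) :=
      ENNReal.Tendsto.sub (ENNReal.Tendsto.const_mul (h1.add_const _) (Or.inr hct)) h2
        (Or.inr ENNReal.zero_ne_top)
    rw [tsub_zero] at h3
    exact h3.liminf_eq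
  have hfatou : c * (A + A) ≤ liminf (fun n => ∫⁻ x, H n x ∂μ) atTop := by
    refine le_trans (le_of_eq ?_) (lintegral_liminf_le' hHm)
    rw [lintegral_congr_ae hlim, lintegral_const_mul' _ _ hct, lintegral_add_left' hGm]
  have hsum : ∀ n, ∫⁻ x, H n x ∂μ + ∫⁻ x, ‖F n x - G x‖ₑ ^ ρ ∂μ =
      c * (∫⁻ x, ‖F n x‖ₑ ^ ρ ∂μ + A) := fun n => by
    rw [← lintegral_add_right' _ (hDm n), ← lintegral_add_right' _ hGm,
      ← lintegral_const_mul' _ _ hct]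
    exact lintegral_congr fun x => tsub_add_cancel_of_le (hpt n x)
  set T := c * (A + A) with hT
  have hTt : T ≠ ⊤ := ENNReal.mul_ne_top hct (ENNReal.add_ne_top.2 ⟨hfin, hfin⟩)
  rw [ENNReal.tendsto_nhds_zero]
  intro δ hδ
  rcases eq_or_ne δ ⊤ with rfl | hδt
  · exact Eventually.of_forall fun _ => le_top
  have hδ2 : δ / 2 ≠ 0 := (ENNReal.half_pos hδ.ne').ne'
  have hδ2t : δ / 2 ≠ ⊤ := (ENNReal.div_lt_top hδt two_ne_zero).ne
  have ev1 : ∀ᶠ n in atTop, T ≤ ∫⁻ x, H n x ∂μ + δ / 2 := by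
    -- The strict inequality `T - δ / 2 < T` needs `T ≠ 0`.
    rcases eq_or_ne T 0 with h0 | h0
    · rw [h0]
      exact Eventually.of_forall fun _ => zero_le
    · have := eventually_lt_of_lt_liminf ((ENNReal.sub_lt_self hTt h0 hδ2).trans_le hfatou)
      filter_upwards [this] with n hn
      exact tsub_le_iff_right.1 hn.le
  -- The slack `δ / 2 / c` becomes `δ / 2` after multiplication by `c`.
  have ev2 := hle (A + δ / 2 / c) (ENNReal.lt_add_right hfin (ENNReal.div_pos hδ2 hct).ne')
  filter_upwards [ev1, ev2] with n h1 h2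
  have h3 : c * (∫⁻ x, ‖F n x‖ₑ ^ ρ ∂μ + A) ≤ T + δ / 2 := by
    calc c * (∫⁻ x, ‖F n x‖ₑ ^ ρ ∂μ + A) ≤ c * (A + δ / 2 / c + A) := by gcongr
      _ = T + c * (δ / 2 / c) := by rw [hT]; ring
      _ = T + δ / 2 := by rw [ENNReal.mul_div_cancel hc0 hct]
  rw [← hsum n] at h3
  have hHt : ∫⁻ x, H n x ∂μ ≠ ⊤ :=
    ne_top_of_le_ne_top (ENNReal.add_ne_top.2 ⟨hTt, hδ2t⟩) (le_self_add.trans h3)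
  have h4 : ∫⁻ x, H n x ∂μ + ∫⁻ x, ‖F n x - G x‖ₑ ^ ρ ∂μ ≤ ∫⁻ x, H n x ∂μ + δ := by
    refine h3.trans ?_
    calc T + δ / 2 ≤ ∫⁻ x, H n x ∂μ + δ / 2 + δ / 2 := by gcongr
      _ = _ := by rw [add_assoc, ENNReal.add_halves]
  exact (ENNReal.add_le_add_iff_left hHt).1 h4

/-- Convergence in `L^ρ` together with an upper bound on the limit of the Gagliardo seminorms
implies convergence in the Gagliardo seminorm, along a subsequence. -/
theorem exists_subseq_tendsto_gagliardo_sub {L s ρ : ℝ} (hρ : 1 ≤ ρ) {w : ℕ → ℝ → E} {u : ℝ → E}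
    (hw : ∀ n, StronglyMeasurable (w n)) (hu : StronglyMeasurable u)
    (hfin : gagliardo L s ρ u ≠ ⊤)
    (hLp : Tendsto (fun n => ∫⁻ x in Ioc 0 L, ‖w n x - u x‖ₑ ^ ρ) atTop (𝓝 0))
    (hle : ∀ B, gagliardo L s ρ u < B → ∀ᶠ n in atTop, gagliardo L s ρ (w n) ≤ B) :
    ∃ φ : ℕ → ℕ, Tendsto (fun n => gagliardo L s ρ (w (φ n) - u)) atTop (𝓝 0) := by
  have hρ0 : 0 < ρ := by linarith
  set μ : Measure ℝ := volume.restrict (Ioc 0 L)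
  have hmeas : TendstoInMeasure μ w atTop u := by
    refine tendstoInMeasure_of_tendsto_eLpNorm (p := ENNReal.ofReal ρ) (by simpa using hρ0)
      (fun n => (hw n).aestronglyMeasurable) hu.aestronglyMeasurable ?_
    have h1 : ∀ n, eLpNorm (w n - u) (ENNReal.ofReal ρ) μ =
        (∫⁻ x in Ioc 0 L, ‖w n x - u x‖ₑ ^ ρ) ^ (1 / ρ) := fun n => by
      rw [eLpNorm_eq_lintegral_rpow_enorm_toReal (by simpa using hρ0) ENNReal.ofReal_ne_top,
        ENNReal.toReal_ofReal hρ0.le]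
      rfl
    simp only [h1]
    have := hLp.ennrpow_const (1 / ρ)
    rwa [ENNReal.zero_rpow_of_pos (by positivity)] at this
  obtain ⟨φ, hφ, hae⟩ := hmeas.exists_seq_tendsto_ae
  refine ⟨φ, ?_⟩
  let k : ℝ × ℝ → ℝ≥0∞ := fun p => circKernel L (1 + s * ρ) (p.1 - p.2)
  have hk : Measurable k := (measurable_circKernel L _).comp (measurable_fst.sub measurable_snd)
  -- The seminorm is an `L^ρ` integral of `f x - f y` for the measure weighted by the kernel, so the
  -- preceding lemma applies; null sets of the product measure stay null for this one.
  have hgag : ∀ f : ℝ → E, StronglyMeasurable f → gagliardo L s ρ f =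
      ∫⁻ p, ‖f p.1 - f p.2‖ₑ ^ ρ ∂((μ.prod μ).withDensity k) := fun f hf => by
    rw [gagliardo_eq_prod L s ρ hf, lintegral_withDensity_eq_lintegral_mul _ hk
      (measurable_enorm_sub_rpow hf ρ)]
    exact lintegral_congr fun p => mul_comm _ _
  have hD : ∀ f : ℝ → E, StronglyMeasurable f →
      StronglyMeasurable fun p : ℝ × ℝ => f p.1 - f p.2 := fun f hf =>
    (hf.comp_measurable measurable_fst).sub (hf.comp_measurable measurable_snd)
  have haep : ∀ᵐ p ∂((μ.prod μ).withDensity k),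
      Tendsto (fun n => w (φ n) p.1 - w (φ n) p.2) atTop (𝓝 (u p.1 - u p.2)) := by
    refine (withDensity_absolutelyContinuous _ _).ae_le ?_
    filter_upwards [Measure.quasiMeasurePreserving_fst.ae hae,
      Measure.quasiMeasurePreserving_snd.ae hae] with p h1 h2
    exact h1.sub h2
  have key := tendsto_lintegral_enorm_sub_rpow hρ
    (F := fun n p => w (φ n) p.1 - w (φ n) p.2) (G := fun p : ℝ × ℝ => u p.1 - u p.2)
    (fun n => (hD _ (hw (φ n))).aestronglyMeasurable) (hD u hu).aestronglyMeasurable haep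
    (by rwa [← hgag u hu]) (fun B hB => by
      rw [← hgag u hu] at hB
      filter_upwards [hφ.tendsto_atTop.eventually (hle B hB)] with n hn
      rwa [← hgag _ (hw _)])
  refine key.congr fun n => ?_
  rw [hgag _ ((hw _).sub hu)]
  refine lintegral_congr fun p => ?_
  simp only [Pi.sub_apply]
  congr 2
  abel

end StrongConvergence

/-! ### The arclength parametrization of the rescaled mollified curve. -/

section Reparametrization

variable {E : Type*} [NormedAddCommGroup E] [InnerProductSpace ℝ E]

/-- The speed of the mollified curve with tangent field `u`, rescaled to length `L`. -/
def rescaledSpeed (L : ℝ) (η : ℝ → ℝ) (u : ℝ → E) (ε x : ℝ) : ℝ :=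
  L / (∫ z in (0 : ℝ)..L, ‖avg (mollifierMeasure η ε) u z‖) * ‖avg (mollifierMeasure η ε) u x‖

/-- The unit tangent of the mollified curve. -/
def mollifiedTangent (η : ℝ → ℝ) (u : ℝ → E) (ε x : ℝ) : E :=
  ‖avg (mollifierMeasure η ε) u x‖⁻¹ • avg (mollifierMeasure η ε) u x

/-- The unit tangent of the arclength parametrization of the rescaled mollified curve. -/
def reparamTangent (L : ℝ) (η : ℝ → ℝ) (u : ℝ → E) (ε t : ℝ) : E :=
  mollifiedTangent η u ε (timeOf (rescaledSpeed L η u ε) t)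

variable {L θ ε s ρ : ℝ} {η : ℝ → ℝ} {γ u : ℝ → E}

theorem IsMollifier.length_bounds (hη : IsMollifier η) (hL : 0 < L) (hε : 0 < ε)
    (hu : IsUnitPeriodic L u) (hloc : LocallyIntegrable u volume)
    (hθ : ∀ x, θ ≤ ‖avg (mollifierMeasure η ε) u x‖) :
    θ * L ≤ ∫ z in (0 : ℝ)..L, ‖avg (mollifierMeasure η ε) u z‖ ∧
      ∫ z in (0 : ℝ)..L, ‖avg (mollifierMeasure η ε) u z‖ ≤ L := by
  have := hη.isProbabilityMeasure hε
  have hi : IntervalIntegrable (fun z => ‖avg (mollifierMeasure η ε) u z‖) volume 0 L :=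
    (hη.continuous_avg hε hloc).norm.intervalIntegrable _ _
  constructor
  · have := intervalIntegral.integral_mono_on hL.le (intervalIntegrable_const (c := θ)) hi
      fun z _ => hθ z
    simpa [mul_comm] using this
  · have := intervalIntegral.integral_mono_on hL.le hi (intervalIntegrable_const (c := (1 : ℝ)))
      fun z _ => hu.norm_avg_le_one z
    simpa using this

theorem IsMollifier.scale_bounds (hη : IsMollifier η) (hL : 0 < L) (hε : 0 < ε)
    (hu : IsUnitPeriodic L u) (hloc : LocallyIntegrable u volume) (hθ0 : 0 < θ)
    (hθ : ∀ x, θ ≤ ‖avg (mollifierMeasure η ε) u x‖) :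
    1 ≤ L / (∫ z in (0 : ℝ)..L, ‖avg (mollifierMeasure η ε) u z‖) ∧
      L / (∫ z in (0 : ℝ)..L, ‖avg (mollifierMeasure η ε) u z‖) ≤ θ⁻¹ := by
  obtain ⟨h1, h2⟩ := hη.length_bounds hL hε hu hloc hθ
  have h0 : 0 < θ * L := by positivity
  constructor
  · rwa [one_le_div (h0.trans_le h1)]
  · rw [div_le_iff₀ (h0.trans_le h1), inv_mul_eq_div, le_div_iff₀ hθ0, mul_comm]
    exact h1

theorem IsMollifier.isSpeed (hη : IsMollifier η) (hL : 0 < L) (hε : 0 < ε)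
    (hu : IsUnitPeriodic L u) (hloc : LocallyIntegrable u volume) (hθ0 : 0 < θ)
    (hθ : ∀ x, θ ≤ ‖avg (mollifierMeasure η ε) u x‖) :
    IsSpeed L θ (rescaledSpeed L η u ε) := by
  have := hη.isProbabilityMeasure hε
  obtain ⟨h1, h2⟩ := hη.scale_bounds hL hε hu hloc hθ0 hθ
  have hlen := (hη.length_bounds hL hε hu hloc hθ).1
  refine ⟨continuous_const.mul (hη.continuous_avg hε hloc).norm, fun x => ?_, hθ0, fun x => ?_,
    fun x => ?_, ?_⟩
  · simp only [rescaledSpeed, hu.avg_periodic x]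
  · exact (hθ x).trans (le_mul_of_one_le_left (norm_nonneg _) h1)
  · refine (mul_le_mul h2 (hu.norm_avg_le_one x) (norm_nonneg _) (by positivity)).trans_eq ?_
    rw [mul_one]
  · simp only [rescaledSpeed]
    rw [intervalIntegral.integral_const_mul, div_mul_cancel₀]
    have : 0 < θ * L := by positivity
    linarith

theorem length_eq_of_isWeakDeriv [CompleteSpace E] (L : ℝ) (h : IsWeakDeriv γ u) :
    length L γ = ∫ z in (0 : ℝ)..L, ‖u z‖ := by
  refine intervalIntegral.integral_congr_ae ?_
  filter_upwards [h.weakDeriv_ae_eq] with x hx _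
  rw [hx]

theorem arclength_eq_of_isWeakDeriv [CompleteSpace E] (h : IsWeakDeriv γ u) (x : ℝ) :
    arclength γ x = ∫ z in (0 : ℝ)..x, ‖u z‖ :=
  length_eq_of_isWeakDeriv x h

theorem IsMollifier.rescaledMollify_eq [CompleteSpace E] (hη : IsMollifier η) (hε : 0 < ε)
    (hu : IsUnitPeriodic L u) (h : IsWeakDeriv γ u) :
    rescaledMollify L η γ ε = fun x =>
      (L / ∫ z in (0 : ℝ)..L, ‖avg (mollifierMeasure η ε) u z‖) • mollify η γ ε x := by
  have h1 : IsWeakDeriv (mollify η γ ε) (avg (mollifierMeasure η ε) u) :=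
    isWeakDeriv_of_hasDerivAt (hη.hasDerivAt_mollify hε h) (hη.continuous_avg hε h.2.1)
  funext x
  simp only [rescaledMollify, length_eq_of_isWeakDeriv L h, length_eq_of_isWeakDeriv L h1,
    hu.norm_eq_one]
  simp

theorem IsMollifier.hasDerivAt_rescaledMollify [CompleteSpace E] (hη : IsMollifier η)
    (hε : 0 < ε) (hu : IsUnitPeriodic L u) (h : IsWeakDeriv γ u) (x : ℝ) :
    HasDerivAt (rescaledMollify L η γ ε)
      ((L / ∫ z in (0 : ℝ)..L, ‖avg (mollifierMeasure η ε) u z‖) •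
        avg (mollifierMeasure η ε) u x) x := by
  rw [hη.rescaledMollify_eq hε hu h]
  exact (hη.hasDerivAt_mollify hε h x).const_smul _

theorem IsMollifier.arclength_rescaledMollify [CompleteSpace E] (hη : IsMollifier η) (hL : 0 < L)
    (hε : 0 < ε) (hu : IsUnitPeriodic L u) (h : IsWeakDeriv γ u) :
    arclength (rescaledMollify L η γ ε) = distanceOf (rescaledSpeed L η u ε) := by
  have h1 := isWeakDeriv_of_hasDerivAt (hη.hasDerivAt_rescaledMollify hε hu h)
    (continuous_const.smul (hη.continuous_avg hε h.2.1))
  have h0 : 0 ≤ L / ∫ z in (0 : ℝ)..L, ‖avg (mollifierMeasure η ε) u z‖ :=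
    div_nonneg hL.le (intervalIntegral.integral_nonneg hL.le fun _ _ => norm_nonneg _)
  funext x
  rw [arclength_eq_of_isWeakDeriv h1, distanceOf]
  refine intervalIntegral.integral_congr fun z _ => ?_
  simp only [norm_smul, rescaledSpeed, Real.norm_of_nonneg h0]

theorem IsMollifier.arclengthParam_eq [CompleteSpace E] (hη : IsMollifier η) (hL : 0 < L)
    (hε : 0 < ε) (hu : IsUnitPeriodic L u) (h : IsWeakDeriv γ u) (t : ℝ) :
    arclengthParam (rescaledMollify L η γ ε) t =
      rescaledMollify L η γ ε (timeOf (rescaledSpeed L η u ε) t) := by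
  rw [arclengthParam, hη.arclength_rescaledMollify hL hε hu h, timeOf]

theorem IsMollifier.hasDerivAt_arclengthParam [CompleteSpace E] (hη : IsMollifier η) (hL : 0 < L)
    (hε : 0 < ε) (hu : IsUnitPeriodic L u) (h : IsWeakDeriv γ u) (hθ0 : 0 < θ)
    (hθ : ∀ x, θ ≤ ‖avg (mollifierMeasure η ε) u x‖) (t : ℝ) :
    HasDerivAt (arclengthParam (rescaledMollify L η γ ε)) (reparamTangent L η u ε t) t := by
  have hv := hη.isSpeed hL hε hu h.2.1 hθ0 hθ
  have h1 := (hη.scale_bounds hL hε hu h.2.1 hθ0 hθ).1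
  have heq : arclengthParam (rescaledMollify L η γ ε) =
      rescaledMollify L η γ ε ∘ timeOf (rescaledSpeed L η u ε) :=
    funext fun t => hη.arclengthParam_eq hL hε hu h t
  rw [heq]
  convert (hη.hasDerivAt_rescaledMollify hε hu h _).scomp t (hv.hasDerivAt_time t) using 1
  -- The scaling factor cancels between the derivative and the inverse speed.
  rw [reparamTangent, mollifiedTangent, rescaledSpeed, smul_smul, mul_inv]
  congr 1
  have : L / (∫ z in (0 : ℝ)..L, ‖avg (mollifierMeasure η ε) u z‖) ≠ 0 := by linarith
  rw [mul_right_comm, inv_mul_cancel₀ this, one_mul]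

theorem IsMollifier.continuous_reparamTangent (hη : IsMollifier η) (hL : 0 < L)
    (hε : 0 < ε) (hu : IsUnitPeriodic L u) (hloc : LocallyIntegrable u volume) (hθ0 : 0 < θ)
    (hθ : ∀ x, θ ≤ ‖avg (mollifierMeasure η ε) u x‖) :
    Continuous (reparamTangent L η u ε) := by
  have hc := hη.continuous_avg hε hloc
  have hn : Continuous (mollifiedTangent η u ε) :=
    (hc.norm.inv₀ fun x => (hθ0.trans_le (hθ x)).ne').smul hc
  exact hn.comp (hη.isSpeed hL hε hu hloc hθ0 hθ).time_continuous

theorem norm_reparamTangent (hθ0 : 0 < θ)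
    (hθ : ∀ x, θ ≤ ‖avg (mollifierMeasure η ε) u x‖) (t : ℝ) :
    ‖reparamTangent L η u ε t‖ = 1 := by
  rw [reparamTangent, mollifiedTangent, norm_smul, norm_inv, norm_norm, inv_mul_cancel₀]
  exact (hθ0.trans_le (hθ _)).ne'

theorem IsMollifier.isWeakDeriv_arclengthParam [CompleteSpace E] (hη : IsMollifier η)
    (hL : 0 < L) (hε : 0 < ε) (hu : IsUnitPeriodic L u) (h : IsWeakDeriv γ u) (hθ0 : 0 < θ)
    (hθ : ∀ x, θ ≤ ‖avg (mollifierMeasure η ε) u x‖) :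
    IsWeakDeriv (arclengthParam (rescaledMollify L η γ ε)) (reparamTangent L η u ε) :=
  isWeakDeriv_of_hasDerivAt (hη.hasDerivAt_arclengthParam hL hε hu h hθ0 hθ)
    (hη.continuous_reparamTangent hL hε hu h.2.1 hθ0 hθ)

theorem IsMollifier.arclengthParam_periodic [CompleteSpace E] (hη : IsMollifier η)
    (hL : 0 < L) (hε : 0 < ε) (hγ : Function.Periodic γ L) (hu : IsUnitPeriodic L u)
    (h : IsWeakDeriv γ u) (hθ0 : 0 < θ)
    (hθ : ∀ x, θ ≤ ‖avg (mollifierMeasure η ε) u x‖) :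
    Function.Periodic (arclengthParam (rescaledMollify L η γ ε)) L := fun t => by
  rw [hη.arclengthParam_eq hL hε hu h, hη.arclengthParam_eq hL hε hu h,
    (hη.isSpeed hL hε hu h.2.1 hθ0 hθ).time_add_period, hη.rescaledMollify_eq hε hu h]
  simp only [hη.mollify_periodic hε hγ _]

theorem IsMollifier.isArclengthParamOf [CompleteSpace E] (hη : IsMollifier η)
    (hL : 0 < L) (hε : 0 < ε) (hγ : Function.Periodic γ L) (hu : IsUnitPeriodic L u)
    (h : IsWeakDeriv γ u) (hθ0 : 0 < θ)
    (hθ : ∀ x, θ ≤ ‖avg (mollifierMeasure η ε) u x‖) :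
    IsArclengthParamOf L (rescaledMollify L η γ ε)
      (arclengthParam (rescaledMollify L η γ ε)) := by
  have hv := hη.isSpeed hL hε hu h.2.1 hθ0 hθ
  have harc := hη.arclength_rescaledMollify hL hε hu h
  have hw := hη.isWeakDeriv_arclengthParam hL hε hu h hθ0 hθ
  refine ⟨?_, fun x => ?_, ?_, hη.arclengthParam_periodic hL hε hγ hu h hθ0 hθ, ⟨_, hw⟩, ?_⟩
  · rw [harc]
    exact hv.bijective
  · rw [hη.arclengthParam_eq hL hε hu h, harc, hv.time_distance]
  · rw [hη.arclengthParam_eq hL hε hu h, hv.time_zero]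
  · filter_upwards [hw.weakDeriv_ae_eq] with t ht
    rw [ht, norm_reparamTangent hθ0 hθ]

/-- The factor by which reparametrization may increase the Gagliardo seminorm. -/
def reparamConst (s ρ θ : ℝ) : ℝ := θ⁻¹ * (θ⁻¹ * θ⁻¹ ^ (1 + s * ρ)) * θ⁻¹ ^ ρ

theorem IsMollifier.gagliardo_reparamTangent_le (hη : IsMollifier η)
    (hL : 0 < L) (hε : 0 < ε) (hρ : 1 ≤ ρ) (hsρ : 0 ≤ s * ρ) (hu : IsUnitPeriodic L u)
    (hloc : LocallyIntegrable u volume) (hθ0 : 0 < θ)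
    (hθ : ∀ x, θ ≤ ‖avg (mollifierMeasure η ε) u x‖) :
    gagliardo L s ρ (reparamTangent L η u ε) ≤
      ENNReal.ofReal (reparamConst s ρ θ) * gagliardo L s ρ u := by
  have := hη.isProbabilityMeasure hε
  have hv := hη.isSpeed hL hε hu hloc hθ0 hθ
  calc gagliardo L s ρ (reparamTangent L η u ε)
      ≤ ENNReal.ofReal (θ⁻¹ * (θ⁻¹ * θ⁻¹ ^ (1 + s * ρ))) *
          gagliardo L s ρ (mollifiedTangent η u ε) :=
        hv.gagliardo_comp_time_le (by linarith) _
    _ ≤ ENNReal.ofReal (θ⁻¹ * (θ⁻¹ * θ⁻¹ ^ (1 + s * ρ))) *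
          (ENNReal.ofReal (θ⁻¹ ^ ρ) * gagliardo L s ρ u) := by
        gcongr
        refine (gagliardo_normalize_le (by linarith) hθ0 hθ).trans ?_
        gcongr
        exact hu.gagliardo_avg_le hL hρ
    _ = _ := by
        rw [← mul_assoc, ← ENNReal.ofReal_mul (by positivity), reparamConst]

theorem IsMollifier.memSobolev_arclengthParam [CompleteSpace E] (hη : IsMollifier η)
    (hL : 0 < L) (hε : 0 < ε) (hρ : 1 ≤ ρ) (hsρ : 0 ≤ s * ρ) (hγ : Function.Periodic γ L)
    (hu : IsUnitPeriodic L u) (h : IsWeakDeriv γ u) (hfin : gagliardo L s ρ u ≠ ⊤)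
    (hθ0 : 0 < θ) (hθ : ∀ x, θ ≤ ‖avg (mollifierMeasure η ε) u x‖) :
    MemSobolev L s ρ (arclengthParam (rescaledMollify L η γ ε)) := by
  have hw := hη.isWeakDeriv_arclengthParam hL hε hu h hθ0 hθ
  have hwc := hη.continuous_reparamTangent hL hε hu h.2.1 hθ0 hθ
  have hd := hη.hasDerivAt_arclengthParam hL hε hu h hθ0 hθ
  have hc : Continuous (arclengthParam (rescaledMollify L η γ ε)) :=
    continuous_iff_continuousAt.2 fun t => (hd t).continuousAt
  refine ⟨hη.arclengthParam_periodic hL hε hγ hu h hθ0 hθ, ⟨_, hw⟩, ?_, ?_, ?_⟩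
  · obtain ⟨C, hC⟩ := (isCompact_Icc (a := (0 : ℝ)) (b := L)).exists_bound_of_continuousOn
      hc.continuousOn
    refine MemLp.of_bound hc.aestronglyMeasurable C ?_
    filter_upwards [ae_restrict_mem measurableSet_Ioc] with t ht
    exact hC t ⟨ht.1.le, ht.2⟩
  · refine (MemLp.of_bound hwc.aestronglyMeasurable 1
      (Eventually.of_forall fun t => (norm_reparamTangent hθ0 hθ t).le)).ae_eq ?_
    exact EventuallyEq.symm (ae_restrict_of_ae hw.weakDeriv_ae_eq)
  · rw [gagliardo_congr_ae L s ρ hw.weakDeriv_ae_eq]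
    exact (hη.gagliardo_reparamTangent_le hL hε hρ hsρ hu h.2.1 hθ0 hθ).trans_lt
      (ENNReal.mul_lt_top ENNReal.ofReal_lt_top hfin.lt_top)

/-- Three errors: the time shift (the rescaled curve is `θ⁻¹`-Lipschitz), the rescaling factor,
which lies in `[1, θ⁻¹]`, and the mollification, which moves `γ` by at most `ε` on `A`. -/
theorem IsMollifier.norm_arclengthParam_sub_le [CompleteSpace E] (hη : IsMollifier η)
    (hL : 0 < L) (hε : 0 < ε) (hu : IsUnitPeriodic L u) (h : IsWeakDeriv γ u) (hθ0 : 0 < θ)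
    (hθ : ∀ x, θ ≤ ‖avg (mollifierMeasure η ε) u x‖) {A : Set ℝ} (hA : ∀ᵐ x, x ∈ A)
    (hLip : ∀ x ∈ A, ∀ y ∈ A, ‖γ x - γ y‖ ≤ |x - y|) {t : ℝ} (ht : t ∈ Ioc 0 L) (htA : t ∈ A) :
    ‖arclengthParam (rescaledMollify L η γ ε) t - γ t‖ ≤
      θ⁻¹ * ((θ⁻¹ - 1) * L) + (θ⁻¹ - 1) * (‖γ t‖ + ε) + ε := by
  have hprob := hη.isProbabilityMeasure hε
  have hv := hη.isSpeed hL hε hu h.2.1 hθ0 hθ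
  obtain ⟨h1, h2⟩ := hη.scale_bounds hL hε hu h.2.1 hθ0 hθ
  have hm := hη.norm_mollify_sub_le hε h.1 hA hLip htA
  have hce := congrFun (hη.rescaledMollify_eq hε hu h) t
  set lam := L / ∫ z in (0 : ℝ)..L, ‖avg (mollifierMeasure η ε) u z‖
  rw [hη.arclengthParam_eq hL hε hu h]
  have e1 : ‖rescaledMollify L η γ ε (timeOf (rescaledSpeed L η u ε) t) -
      rescaledMollify L η γ ε t‖ ≤ θ⁻¹ * ((θ⁻¹ - 1) * L) := by
    have hb : ∀ z, ‖lam • avg (mollifierMeasure η ε) u z‖ ≤ θ⁻¹ := fun z => by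
      rw [norm_smul, Real.norm_of_nonneg (by linarith)]
      exact hv.le_inv z
    have := Convex.norm_image_sub_le_of_norm_hasDerivWithin_le (s := univ) (C := θ⁻¹)
      (fun z _ => (hη.hasDerivAt_rescaledMollify hε hu h z).hasDerivWithinAt)
      (fun z _ => hb z) convex_univ (mem_univ t) (mem_univ (timeOf (rescaledSpeed L η u ε) t))
    exact this.trans (mul_le_mul_of_nonneg_left (hv.abs_time_sub_le ht) (by positivity))
  have e2 : ‖rescaledMollify L η γ ε t - mollify η γ ε t‖ ≤ (θ⁻¹ - 1) * (‖γ t‖ + ε) := by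
    have : rescaledMollify L η γ ε t - mollify η γ ε t = (lam - 1) • mollify η γ ε t := by
      rw [hce, sub_smul, one_smul]
    rw [this, norm_smul, Real.norm_of_nonneg (by linarith)]
    refine mul_le_mul (by linarith) ?_ (norm_nonneg _) (by linarith)
    have := norm_add_le (γ t) (mollify η γ ε t - γ t)
    rw [add_sub_cancel] at this
    linarith
  calc _ = ‖(rescaledMollify L η γ ε (timeOf (rescaledSpeed L η u ε) t) -
        rescaledMollify L η γ ε t) + (rescaledMollify L η γ ε t - mollify η γ ε t) +
        (mollify η γ ε t - γ t)‖ := by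
        congr 1
        abel
    _ ≤ _ := (norm_add₃_le).trans (by linarith)

end Reparametrization

/-! ### Convergence of the curves, of the tangents, and of the seminorm. -/

section Convergence

variable {E : Type*} [NormedAddCommGroup E] [InnerProductSpace ℝ E]
variable {L s ρ : ℝ} {η : ℝ → ℝ} {γ u : ℝ → E}

theorem exists_pos_ofReal_rpow_mul_le (L : ℝ) {ρ : ℝ} (hρ : 0 < ρ) {κ : ℝ≥0∞} (hκ : 0 < κ) :
    ∃ r : ℝ, 0 < r ∧ ENNReal.ofReal r ^ ρ * ENNReal.ofReal L ≤ κ := by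
  have h1 : Tendsto (fun r : ℝ => ENNReal.ofReal r ^ ρ * ENNReal.ofReal L) (𝓝[>] 0) (𝓝 0) := by
    have h2 : Tendsto (fun r : ℝ => ENNReal.ofReal r) (𝓝[>] 0) (𝓝 (ENNReal.ofReal 0)) :=
      ENNReal.tendsto_ofReal (tendsto_id.mono_left nhdsWithin_le_nhds)
    have := ENNReal.Tendsto.mul_const (h2.ennrpow_const ρ) (b := ENNReal.ofReal L)
      (Or.inr ENNReal.ofReal_ne_top)
    simpa [ENNReal.zero_rpow_of_pos hρ] using this
  obtain ⟨r, h2, h3⟩ := ((h1.eventually (ge_mem_nhds hκ)).and self_mem_nhdsWithin).exists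
  exact ⟨r, h3, h2⟩

theorem setLIntegral_enorm_rpow_le_of_norm_le {F : Type*} [NormedAddCommGroup F] {L ρ r : ℝ}
    (hρ : 0 ≤ ρ) {f : ℝ → F}
    (hf : ∀ᵐ t ∂(volume.restrict (Ioc 0 L)), ‖f t‖ ≤ r) :
    ∫⁻ t in Ioc 0 L, ‖f t‖ₑ ^ ρ ≤ ENNReal.ofReal r ^ ρ * ENNReal.ofReal L := by
  calc ∫⁻ t in Ioc 0 L, ‖f t‖ₑ ^ ρ ≤ ∫⁻ _ in Ioc 0 L, ENNReal.ofReal r ^ ρ := by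
        refine lintegral_mono_ae ?_
        filter_upwards [hf] with t ht
        refine ENNReal.rpow_le_rpow ?_ hρ
        rw [← ofReal_norm]
        exact ENNReal.ofReal_le_ofReal ht
    _ = _ := by simp

/-- Serves to fix `θ` before `ε`: the error bounds are continuous in `θ` at 1. The bound `1 / 2 < θ`
keeps `θ⁻¹` below 2. -/
theorem exists_theta {g : ℝ → ℝ} (hg : ContinuousAt g 1) {B : ℝ} (hB : g 1 < B) :
    ∃ θ, 1 / 2 < θ ∧ θ < 1 ∧ g θ < B := by
  have h1 : ∀ᶠ θ in 𝓝[<] (1 : ℝ), g θ < B :=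
    (hg.eventually (gt_mem_nhds hB)).filter_mono nhdsWithin_le_nhds
  obtain ⟨θ, h2, h3⟩ := (h1.and (Ioo_mem_nhdsLT (show (1 / 2 : ℝ) < 1 by norm_num))).exists
  exact ⟨θ, h3.1, h3.2, h2⟩

theorem IsMollifier.tendsto_lintegral_arclengthParam_sub [CompleteSpace E] (hη : IsMollifier η)
    (hL : 0 < L) (hρ : 1 ≤ ρ) (hsρ : 1 ≤ s * ρ)
    (hu : IsUnitPeriodic L u) (h : IsWeakDeriv γ u) (hfin : gagliardo L s ρ u ≠ ⊤) :
    Tendsto (fun ε => ∫⁻ t in Ioc 0 L,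
      ‖(arclengthParam (rescaledMollify L η γ ε) - γ) t‖ₑ ^ ρ) (𝓝[>] 0) (𝓝 0) := by
  obtain ⟨A, hA, hLip⟩ := h.ae_lipschitz hu.norm_eq_one
  obtain ⟨a, ha⟩ := hA.exists
  set K := ‖γ a‖ + (L + |a|)
  have hK : ∀ t ∈ Ioc 0 L, t ∈ A → ‖γ t‖ ≤ K := fun t ht htA => by
    have h1 := hLip t htA a ha
    have h2 := norm_add_le (γ a) (γ t - γ a)
    rw [add_sub_cancel] at h2
    have h3 := abs_sub t a
    rw [abs_of_pos ht.1] at h3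
    linarith [ht.2]
  rw [ENNReal.tendsto_nhds_zero]
  intro κ hκ
  obtain ⟨r, hr, hrκ⟩ := exists_pos_ofReal_rpow_mul_le L (ρ := ρ) (by linarith) hκ
  obtain ⟨θ, hθ2, hθ1, hθr⟩ := exists_theta
    (g := fun θ => θ⁻¹ * ((θ⁻¹ - 1) * L) + (θ⁻¹ - 1) * (K + 1)) (B := r / 2)
    (by
      have : ContinuousAt (fun θ : ℝ => θ⁻¹) 1 := continuousAt_inv₀ one_ne_zero
      fun_prop) (by simpa using hr)
  have hθ0 : 0 < θ := by linarith
  have hinv : 0 ≤ θ⁻¹ - 1 := sub_nonneg.2 ((one_le_inv₀ hθ0).2 hθ1.le)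
  filter_upwards [hη.eventually_le_norm_avg hL hρ hsρ hu hfin hθ1, Ioo_mem_nhdsGT one_pos,
    Ioo_mem_nhdsGT (half_pos hr)] with ε hθ hε1 hεr
  refine (setLIntegral_enorm_rpow_le_of_norm_le (by linarith) ?_).trans hrκ
  filter_upwards [ae_restrict_mem measurableSet_Ioc, ae_restrict_of_ae hA] with t ht htA
  refine (hη.norm_arclengthParam_sub_le hL hε1.1 hu h hθ0 hθ hA hLip ht htA).trans ?_
  have : (θ⁻¹ - 1) * (‖γ t‖ + ε) ≤ (θ⁻¹ - 1) * (K + 1) :=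
    mul_le_mul_of_nonneg_left (by linarith [hK t ht htA, hε1.2]) hinv
  linarith [hεr.2]

theorem norm_normalize_sub_le_two_mul {a e : E} (he : ‖e‖ = 1) (ha : a ≠ 0) :
    ‖‖a‖⁻¹ • a - e‖ ≤ 2 * ‖e - a‖ := by
  have ha0 : ‖a‖ ≠ 0 := norm_ne_zero_iff.2 ha
  have h1 : ‖‖a‖⁻¹ • a - a‖ ≤ ‖e - a‖ := by
    have h2 : ‖a‖⁻¹ • a - a = (1 - ‖a‖) • (‖a‖⁻¹ • a) := by
      rw [sub_smul, one_smul, smul_smul, mul_inv_cancel₀ ha0, one_smul]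
    rw [h2, norm_smul, norm_smul, norm_inv, norm_norm, inv_mul_cancel₀ ha0, mul_one, ← he]
    exact abs_norm_sub_norm_le e a
  have h3 := norm_add_le (‖a‖⁻¹ • a - a) (a - e)
  rw [sub_add_sub_cancel, norm_sub_rev a e] at h3
  linarith

/-- Splits `n ∘ τ - u` into `n ∘ τ - b ∘ τ`, `b ∘ τ - b` and `b - u`. Since `u` may be
discontinuous, `u ∘ τ - u` has no pointwise bound; the average `b` at scale `δ` is continuous and
independent of `ε`. -/
theorem IsMollifier.lintegral_reparamTangent_sub_le {ε δ θ : ℝ} (hη : IsMollifier η)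
    (hL : 0 < L) (hρ : 1 ≤ ρ) (hε : 0 < ε) (hδ : 0 < δ) (hu : IsUnitPeriodic L u)
    (hloc : LocallyIntegrable u volume) (hθ2 : 1 / 2 < θ)
    (hθ : ∀ x, θ ≤ ‖avg (mollifierMeasure η ε) u x‖) {x : ℝ≥0∞}
    (h1 : ∫⁻ z in Ioc 0 L, ‖u z - avg (mollifierMeasure η ε) u z‖ₑ ^ ρ ≤ x)
    (h2 : ∫⁻ z in Ioc 0 L, ‖u z - avg (mollifierMeasure η δ) u z‖ₑ ^ ρ ≤ x)
    (h3 : ∫⁻ t in Ioc 0 L, ‖avg (mollifierMeasure η δ) u (timeOf (rescaledSpeed L η u ε) t) -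
      avg (mollifierMeasure η δ) u t‖ₑ ^ ρ ≤ x) :
    ∫⁻ t in Ioc 0 L, ‖reparamTangent L η u ε t - u t‖ₑ ^ ρ ≤
      2 ^ (ρ - 1) * (2 ^ (ρ - 1) * (2 * (2 ^ (ρ - 1) * (2 ^ ρ + 1)) + 1) + 1) * x := by
  have hθ0 : 0 < θ := by linarith
  have hρ0 : 0 ≤ ρ := by linarith
  set c : ℝ≥0∞ := 2 ^ (ρ - 1)
  set a := avg (mollifierMeasure η ε) u
  set b := avg (mollifierMeasure η δ) u
  set n := mollifiedTangent η u ε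
  set τ := timeOf (rescaledSpeed L η u ε)
  have hv := hη.isSpeed hL hε hu hloc hθ0 hθ
  have hbc : Continuous b := hη.continuous_avg hδ hloc
  have hτ : Continuous τ := hv.time_continuous
  have hum := hu.stronglyMeasurable
  have hn : ∫⁻ z in Ioc 0 L, ‖n z - u z‖ₑ ^ ρ ≤ 2 ^ ρ * x := by
    refine le_trans ?_ (mul_le_mul_right h1 _)
    rw [← lintegral_const_mul' _ _ (ENNReal.rpow_ne_top_of_nonneg hρ0 ENNReal.ofNat_ne_top)]
    refine lintegral_mono fun z => ?_
    rw [← ENNReal.mul_rpow_of_nonneg _ _ hρ0]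
    refine ENNReal.rpow_le_rpow ?_ hρ0
    have := norm_normalize_sub_le_two_mul (hu.norm_eq_one z)
      (norm_ne_zero_iff.1 (hθ0.trans_le (hθ z)).ne')
    rw [← ofReal_norm, ← ofReal_norm, ← ENNReal.ofReal_ofNat 2, ← ENNReal.ofReal_mul two_pos.le]
    exact ENNReal.ofReal_le_ofReal this
  have hnb : ∫⁻ z in Ioc 0 L, ‖n z - b z‖ₑ ^ ρ ≤ c * (2 ^ ρ * x + x) := by
    have := lintegral_enorm_add_rpow_le (μ := volume.restrict (Ioc 0 L)) hρ
      (f := fun z => n z - u z) (g := fun z => u z - b z)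
      (hum.sub hbc.stronglyMeasurable).aestronglyMeasurable
    simp only [sub_add_sub_cancel] at this
    exact this.trans (mul_le_mul_right (add_le_add hn h2) _)
  have hT1 : ∫⁻ t in Ioc 0 L, ‖n (τ t) - b (τ t)‖ₑ ^ ρ ≤ 2 * (c * (2 ^ ρ * x + x)) := by
    refine (hv.lintegral_comp_time_le (fun z => ‖n z - b z‖ₑ ^ ρ)).trans (mul_le_mul' ?_ hnb)
    rw [← ENNReal.ofReal_ofNat 2]
    refine ENNReal.ofReal_le_ofReal ?_
    rw [inv_le_comm₀ hθ0 two_pos]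
    linarith
  have hT12 : ∫⁻ t in Ioc 0 L, ‖n (τ t) - b t‖ₑ ^ ρ ≤ c * (2 * (c * (2 ^ ρ * x + x)) + x) := by
    have := lintegral_enorm_add_rpow_le (μ := volume.restrict (Ioc 0 L)) hρ
      (f := fun t => n (τ t) - b (τ t)) (g := fun t => b (τ t) - b t)
      ((hbc.comp hτ).sub hbc).aestronglyMeasurable
    simp only [sub_add_sub_cancel] at this
    exact this.trans (mul_le_mul_right (add_le_add hT1 h3) _)
  have h2' : ∫⁻ t in Ioc 0 L, ‖b t - u t‖ₑ ^ ρ ≤ x := by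
    refine le_trans (le_of_eq (lintegral_congr fun t => ?_)) h2
    rw [← enorm_neg, neg_sub]
  have := lintegral_enorm_add_rpow_le (μ := volume.restrict (Ioc 0 L)) hρ
    (f := fun t => n (τ t) - b t) (g := fun t => b t - u t)
    (hbc.stronglyMeasurable.sub hum).aestronglyMeasurable
  simp only [sub_add_sub_cancel] at this
  refine (this.trans (mul_le_mul_right (add_le_add hT12 h2') _)).trans_eq ?_
  ring

theorem IsMollifier.tendsto_lintegral_reparamTangent_sub [CompleteSpace E] (hη : IsMollifier η)
    (hL : 0 < L) (hs : 0 < s) (hρ : 1 ≤ ρ) (hsρ : 1 ≤ s * ρ) (hu : IsUnitPeriodic L u)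
    (hloc : LocallyIntegrable u volume) (hfin : gagliardo L s ρ u ≠ ⊤) :
    Tendsto (fun ε => ∫⁻ t in Ioc 0 L, ‖reparamTangent L η u ε t - u t‖ₑ ^ ρ)
      (𝓝[>] 0) (𝓝 0) := by
  set K : ℝ≥0∞ := 2 ^ (ρ - 1) * (2 ^ (ρ - 1) * (2 * (2 ^ (ρ - 1) * (2 ^ ρ + 1)) + 1) + 1)
  have hKt : K ≠ ⊤ := by
    have h1 : (2 : ℝ≥0∞) ^ (ρ - 1) ≠ ⊤ :=
      ENNReal.rpow_ne_top_of_nonneg (by linarith) ENNReal.ofNat_ne_top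
    have h2 : (2 : ℝ≥0∞) ^ ρ ≠ ⊤ :=
      ENNReal.rpow_ne_top_of_nonneg (by linarith) ENNReal.ofNat_ne_top
    finiteness
  rw [ENNReal.tendsto_nhds_zero]
  intro κ hκ
  have hx : 0 < κ / K := ENNReal.div_pos hκ.ne' hKt
  have hlim := ENNReal.tendsto_nhds_zero.1
    (hη.tendsto_lintegral_avg_sub hL hs hρ hu hfin) (κ / K) hx
  -- Order of choices: `δ` fixes the comparison field, its modulus of continuity gives `d`, `d`
  -- gives `θ`, and `ε` comes last.
  obtain ⟨δ, hδx, hδ⟩ := (hlim.and self_mem_nhdsWithin).exists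
  have hδ0 : 0 < δ := hδ
  obtain ⟨r, hr, hrκ⟩ := exists_pos_ofReal_rpow_mul_le L (ρ := ρ) (by linarith) hx
  have huc : UniformContinuousOn (avg (mollifierMeasure η δ) u) (Icc 0 L) :=
    isCompact_Icc.uniformContinuousOn_of_continuous (hη.continuous_avg hδ0 hloc).continuousOn
  obtain ⟨d, hd, hdr⟩ := Metric.uniformContinuousOn_iff.1 huc r hr
  obtain ⟨θ, hθ2, hθ1, hθd⟩ := exists_theta (g := fun θ => (θ⁻¹ - 1) * L) (B := d)
    (by
      have : ContinuousAt (fun θ : ℝ => θ⁻¹) 1 := continuousAt_inv₀ one_ne_zero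
      fun_prop) (by simpa using hd)
  have hθ0 : 0 < θ := by linarith
  filter_upwards [hη.eventually_le_norm_avg hL hρ hsρ hu hfin hθ1, self_mem_nhdsWithin,
    hlim] with ε hθ hε hεx
  have hv := hη.isSpeed hL hε hu hloc hθ0 hθ
  refine (hη.lintegral_reparamTangent_sub_le hL hρ hε hδ0 hu hloc hθ2 hθ hεx hδx ?_).trans
    ENNReal.mul_div_le
  refine (setLIntegral_enorm_rpow_le_of_norm_le (by linarith) ?_).trans hrκ
  filter_upwards [ae_restrict_mem measurableSet_Ioc] with t ht
  have ht' := hv.mapsTo_time ht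
  have := hdr _ ⟨ht'.1.le, ht'.2⟩ t ⟨ht.1.le, ht.2⟩ ((hv.abs_time_sub_le ht).trans_lt hθd)
  rw [dist_eq_norm] at this
  exact this.le

theorem IsMollifier.eventually_gagliardo_reparamTangent_le [CompleteSpace E] (hη : IsMollifier η)
    (hL : 0 < L) (hρ : 1 ≤ ρ) (hsρ : 1 ≤ s * ρ) (hu : IsUnitPeriodic L u)
    (hloc : LocallyIntegrable u volume) (hfin : gagliardo L s ρ u ≠ ⊤) {B : ℝ≥0∞}
    (hB : gagliardo L s ρ u < B) :
    ∀ᶠ ε in 𝓝[>] (0 : ℝ), gagliardo L s ρ (reparamTangent L η u ε) ≤ B := by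
  have hcont : ContinuousAt (reparamConst s ρ) 1 := by
    have h1 : ContinuousAt (fun θ : ℝ => θ⁻¹) 1 := continuousAt_inv₀ one_ne_zero
    have h2 : ∀ p : ℝ, ContinuousAt (fun θ : ℝ => θ⁻¹ ^ p) 1 := fun p =>
      h1.rpow_const (Or.inl (by norm_num))
    exact (h1.mul (h1.mul (h2 _))).mul (h2 _)
  have hlim : Tendsto (fun θ => ENNReal.ofReal (reparamConst s ρ θ) * gagliardo L s ρ u)
      (𝓝[<] 1) (𝓝 (gagliardo L s ρ u)) := by
    have h1 := ENNReal.Tendsto.mul_const (ENNReal.tendsto_ofReal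
      (hcont.tendsto.mono_left (nhdsWithin_le_nhds (s := Iio 1)))) (b := gagliardo L s ρ u)
      (Or.inr hfin)
    simpa [reparamConst] using h1
  obtain ⟨θ, hθB, hθI⟩ := ((hlim.eventually (gt_mem_nhds hB)).and
    (Ioo_mem_nhdsLT (zero_lt_one' ℝ))).exists
  filter_upwards [hη.eventually_le_norm_avg hL hρ hsρ hu hfin hθI.2, self_mem_nhdsWithin]
    with ε hθ hε
  exact (hη.gagliardo_reparamTangent_le hL hε hρ (by linarith) hu hloc hθI.1 hθ).trans hθB.le

theorem IsMollifier.tendsto_gagliardo_reparamTangent_sub [CompleteSpace E] (hη : IsMollifier η)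
    (hL : 0 < L) (hs : 0 < s) (hρ : 1 ≤ ρ) (hsρ : 1 ≤ s * ρ) (hu : IsUnitPeriodic L u)
    (hloc : LocallyIntegrable u volume) (hfin : gagliardo L s ρ u ≠ ⊤) :
    Tendsto (fun ε => gagliardo L s ρ (reparamTangent L η u ε - u)) (𝓝[>] 0) (𝓝 0) := by
  -- The a.e. convergence holds only along subsequences; the limit 0 does not depend on the one
  -- extracted.
  refine tendsto_of_subseq_tendsto fun ns hns => ?_
  have hgood : ∀ᶠ ε in 𝓝[>] (0 : ℝ), Continuous (reparamTangent L η u ε) := by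
    filter_upwards [hη.eventually_le_norm_avg hL hρ hsρ hu hfin one_half_lt_one,
      self_mem_nhdsWithin] with ε hθ hε
    exact hη.continuous_reparamTangent hL hε hu hloc one_half_pos hθ
  obtain ⟨N, hN⟩ := eventually_atTop.1 (hns.eventually hgood)
  -- Dropping the first `N` terms makes every tangent field continuous, hence measurable.
  have hns' : Tendsto (fun n => ns (n + N)) atTop (𝓝[>] 0) :=
    hns.comp (tendsto_add_atTop_nat N)
  obtain ⟨φ, hφ⟩ := exists_subseq_tendsto_gagliardo_sub (s := s) hρ
    (w := fun n => reparamTangent L η u (ns (n + N)))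
    (fun n => (hN _ (Nat.le_add_left _ _)).stronglyMeasurable) hu.stronglyMeasurable hfin
    ((hη.tendsto_lintegral_reparamTangent_sub hL hs hρ hsρ hu hloc hfin).comp hns')
    (fun B hB => hns'.eventually
      (hη.eventually_gagliardo_reparamTangent_le hL hρ hsρ hu hloc hfin hB))
  exact ⟨fun n => φ n + N, hφ⟩

end Convergence

end FracSobolev

end

/-! ### The theorem. -/

open FracSobolev

theorem theorem4p2 (L s ρ : ℝ) (hL : 0 < L) (hs : s ∈ Set.Ioo (0 : ℝ) 1) (hρ : 1 / s ≤ ρ)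
    (η : ℝ → ℝ) (hη : FracSobolev.IsMollifier η)
    (γ : ℝ → EuclideanSpace ℝ (Fin 3))
    (hγ : FracSobolev.MemSobolev L s ρ γ) (hγ_arc : FracSobolev.IsUnitSpeed γ) :
    (∀ᶠ ε in 𝓝[>] (0 : ℝ),
      FracSobolev.IsArclengthParamOf L (FracSobolev.rescaledMollify L η γ ε)
        (FracSobolev.arclengthParam (FracSobolev.rescaledMollify L η γ ε)) ∧
      FracSobolev.MemSobolev L s ρ
        (FracSobolev.arclengthParam (FracSobolev.rescaledMollify L η γ ε))) ∧
    Tendsto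
      (fun ε : ℝ => FracSobolev.sobolevNorm L s ρ
        (FracSobolev.arclengthParam (FracSobolev.rescaledMollify L η γ ε) - γ))
      (𝓝[>] 0) (𝓝 0) := by
  have hsρ : 1 ≤ s * ρ := by
    rw [div_le_iff₀ hs.1] at hρ
    linarith
  have hρ1 : 1 ≤ ρ := by
    refine le_trans ?_ hρ
    rw [le_div_iff₀ hs.1]
    linarith [hs.2]
  obtain ⟨u, hwu, hum, hup, hun⟩ :=
    (isWeakDeriv_weakDeriv hγ.exists_weakDeriv).exists_periodic_unit hL hγ.periodic hγ_arc
  have hu : IsUnitPeriodic L u := ⟨hum, hup, hun⟩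
  have hfin : gagliardo L s ρ u ≠ ⊤ := by
    rw [← gagliardo_congr_ae L s ρ hwu.weakDeriv_ae_eq]
    exact hγ.gagliardo_lt_top.ne
  -- For regularity and bijectivity any positive lower bound on the speed suffices; `1 / 2` is
  -- taken.
  have hev := (hη.eventually_le_norm_avg hL hρ1 hsρ hu hfin one_half_lt_one).and
    self_mem_nhdsWithin
  constructor
  · filter_upwards [hev] with ε ⟨hθ, hε⟩
    exact ⟨hη.isArclengthParamOf hL hε hγ.periodic hu hwu one_half_pos hθ,
      hη.memSobolev_arclengthParam hL hε hρ1 (by linarith) hγ.periodic hu hwu hfin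
        one_half_pos hθ⟩
  · have h1 := hη.tendsto_lintegral_arclengthParam_sub hL hρ1 hsρ hu hwu hfin
    have h2 := hη.tendsto_lintegral_reparamTangent_sub hL hs.1 hρ1 hsρ hu hwu.2.1 hfin
    have h3 := hη.tendsto_gagliardo_reparamTangent_sub hL hs.1 hρ1 hsρ hu hwu.2.1 hfin
    have h4 := ((h1.add h2).add h3).ennrpow_const (1 / ρ)
    rw [add_zero, add_zero, ENNReal.zero_rpow_of_pos (by positivity)] at h4
    refine h4.congr' ?_
    filter_upwards [hev] with ε ⟨hθ, hε⟩
    -- `weakDeriv` of the difference is an arbitrary representative, known only up to null sets,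
    -- which none of the integrals sees.
    have hw := ((hη.isWeakDeriv_arclengthParam hL hε hu hwu one_half_pos hθ).sub
      hwu).weakDeriv_ae_eq
    rw [sobolevNorm, gagliardo_congr_ae L s ρ hw]
    congr 3
    refine lintegral_congr_ae ?_
    filter_upwards [ae_restrict_of_ae hw] with t ht
    rw [ht, Pi.sub_apply]
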